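/- **Model.** Fix a cluster radius $R_c>0$, a power $P>0$, a rate $R>0$, a parameter $0<\varepsilon\le 1$, an integer $n_{m,\max}\ge 0$, densities $\lambda_r,\lambda_u>0$, a library size $L$ and a cache size $M$, probability laws $p_V,p_A$ on $\{1,\dots,L\}$, a measurable path loss $l:[0,\infty)\to[0,\infty)$, a fading law on $[0,\infty)$, and a Markov kernel giving, for each distance, the law of the intra-cluster gain $|g|^2\in[0,\infty)$ of two users at that distance; $\bar F_{|g_{s,d}|^2}$ is the complementary cdf of that law at the distance $\|s-d\|$. Let $\Phi_p$ be a stationary hard-core point process in $\mathbb R^2$ of intensity $\lambda_p>0$ and clearance $\delta\ge 2R_c$. Every point $x\in\Phi_p$ is the centre of a cluster $\mathcal B(x,R_c)$ and carries a mark; the marks are i.i.d. and independent of $\Phi_p$. A mark consists of - independent Poisson numbers $N_u$ of caching and $N_r$ of requesting users, with means $\lambda_u\pi R_c^2$ and $\lambda_r\pi R_c^2$; - their positions $S_j$, $D_i$ relative to $x$, i.i.d. uniform on $\mathcal B(0,R_c)$; - the $M$ videos stored by each caching user, i.i.d. with law $p_A$, and the requested videos, i.i.d. with law $p_V$; numbers,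 positions and videos are independent of each other; - the gains $|g_{S_j,D_i}|^2$, which given the positions are independent of each other and of everything else, with the above laws. The inter-cluster fading coefficients $|h|^2$ (one for each pair of a transmitter and a requesting user in different clusters) are i.i.d. with the fading law and independent of everything. $\mathbb E^0$ is the expectation under the Palm distribution of this marked network, with a cluster at the origin. **Strategy $\mathcal F^*$.** Request $i$ of a cluster is matched (event $\mathcal M_i$) if some caching user of the cluster stores the requested video; $N_m$ is the number of matched requests. Put $W_L(N)=2^{\lfloor\log_2N\rfloor}$, $W_H(N)=2^{\lceil\log_2N\rceil}$ for $N\ge1$. A cluster with $N_m=N$ splits the block into $W(N)$ equal slots, where $W(N)=N$ if $N\ge 1$ is a power of two, and otherwise $W(N)=W_L(N)$ if $\frac{N-W_L(N)}{W_H(N)-W_L(N)}<\varepsilon$ and $W(N)=W_H(N)$ if not; by convention $W(0)=W_L(0)=W_H(0)=1$, the slot being idle. Each matched request gets as its source $C_i$ a uniformly chosen caching user of the cluster that stores the video. If $W(N)\ge N$, the matched requests are placed in uniformly random distinct slots; if $W(N)<N$, then $N-W(N)$ of them, chosen uniformly, are dropped and the others are assigned to the slots by a uniform permutation. All these choices are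 independent of each other and of the rest given the matches. $\mathcal P_i$ is the event that request $i$ is scheduled. For the interference every idle slot is filled with its own fictitious transmitter, at an independent uniform position of the cluster and with independent fading. **Interference.** Let $\Delta=W_H(n_{m,\max})$. In a given slot of a block with $n$ slots (a power of two), the interference at a point $d$ of the cluster at the origin is $$I(d,n)=\sum_{x\in\Phi_p\setminus\{0\}}P\Big\{\mathbb 1_{\{W_x\le n\}}|h_{x,d}|^2\,l(\|x+S_x-d\|)+\sum_{i=\log_2n+1}^{\log_2\Delta}\mathbb 1_{\{W_x=2^i\}}\frac n{2^i}\sum_jB_{x,j,i}\,|h_{x,j,d}|^2\,l(\|x+S_{x,j}-d\|)\Big\}\in[0,\infty].$$ Here $W_x$ is the number of slots of the cluster at $x$; in the first term $S_x$ is the relative position of the transmitter active in the slot of that cluster which contains the given slot; in the second term $j$ runs over the transmitters active in the $2^i/n$ slots of that cluster contained in the given slot, $S_{x,j}$ is the relative position of the $j$-th of them and $B_{x,j,i}\ge1$ the number of those slots which it uses, so that $\sum_jB_{x,j,i}=2^i/n$. A request $i$ is served (event $\mathcal S_i$) if it is matched and scheduled and $$R<R_a=\frac1{W(N_m)}\log_2\Big(1+\frac{P|g_{S_{C_i},D_i}|^2}{I(D_i,W(N_m))}\Big),$$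 with the interference of its own slot; for a cluster not at the origin everything is taken relative to its centre. **Metrics.** With $N_s(K)$ the number of served requests of users located in $K$, and $0/0=0$, $$T_L=\frac{\mathbb E^0\big[\sum_{i\le N_r}\mathbb 1_{\mathcal S_i}\big]}{\mathbb E^0[N_r]},\qquad T_G=\frac{\mathbb E[N_s(K)]}{\lambda_r|K|},\qquad \bar R=R\;\mathbb E^0\Big[\sum_{i\le N_r}\frac{\mathbb 1_{\mathcal S_i}}{\sum_{j\le N_r}\mathbb 1_{\mathcal M_j\cap\mathcal P_j}}\Big].$$ **Theorem.** Under $\mathbb E^0$ let $S,D$ be uniform on $\mathcal B(0,R_c)$, independent of each other and of the network, and let $I(D,W(N_m))$ be the interference at $D$ (with fading coefficients towards $D$ that are independent of everything) during a slot; any fixed choice of one slot for each number of slots may be taken. Put $$\Psi=\bar F_{|g_{S,D}|^2|S,D}\Big(\tfrac1P\,I(D,W(N_m))\,\big(2^{W(N_m)R}-1\big)\Big).$$ Then $$T_L=\frac{\mathbb E^0\Big[\big(N_m\mathbb 1_{\{W(N_m)=W_H(N_m)\}}+W_L(N_m)\mathbb 1_{\{W(N_m)\ne W_H(N_m)\}}\big)\Psi\Big]}{\mathbb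 E^0[N_r]};$$ for every compact $K\subset\mathbb R^2$ with $|K|>0$ one has $T_G=\lambda_p\,|\mathcal B(0,R_c)|\,T_L$; and $$\bar R=R\;\mathbb E^0\big[\mathbb 1_{\{N_m\ge1\}}\Psi\big].$$ -/

import Mathlib

open MeasureTheory ProbabilityTheory
open scoped NNReal ENNReal

noncomputable section

/-! ### Parameters of the model -/

/-- The plane in which the users live. -/
abbrev Plane : Type := EuclideanSpace ℝ (Fin 2)

/-- Parameters of the network and of the transmission strategy. The library has `L` videos and every
caching user stores `M` of them. -/
structure D2DParams (L M : ℕ) where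
  /-- cluster radius -/
  Rc : ℝ
  /-- transmission power -/
  P : ℝ
  /-- attempted rate -/
  R : ℝ
  /-- the design parameter of the strategy -/
  eps : ℝ
  /-- density of requesting users -/
  lamR : ℝ
  /-- density of caching users -/
  lamU : ℝ
  /-- the maximal number of slots is determined by `nmax` -/
  nmax : ℕ
  /-- law of a requested video -/
  pV : PMF (Fin L)
  /-- law of a cached video -/
  pA : PMF (Fin L)
  /-- path loss between different clusters, as a function of the distance -/
  pathLoss : ℝ≥0 → ℝ≥0
  /-- law of the fading coefficient `|h|²` between different clusters -/
  fadingLaw : Measure ℝ≥0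
  /-- law of the power attenuation `|g|²` inside a cluster, given the distance of the two users -/
  gainLaw : Kernel ℝ≥0 ℝ≥0
  Rc_pos : 0 < Rc
  P_pos : 0 < P
  R_pos : 0 < R
  eps_pos : 0 < eps
  eps_le_one : eps ≤ 1
  lamR_pos : 0 < lamR
  lamU_pos : 0 < lamU
  measurable_pathLoss : Measurable pathLoss
  isProbabilityMeasure_fadingLaw : IsProbabilityMeasure fadingLaw
  isMarkovKernel_gainLaw : IsMarkovKernel gainLaw

attribute [instance] D2DParams.isProbabilityMeasure_fadingLaw D2DParams.isMarkovKernel_gainLaw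

/-! ### The parent point process -/

/-- A labelled point configuration: the label `k` is in use iff `(g k).1 = true`, and then it
carries the point `(g k).2`. -/
abbrev Ground : Type := ℕ → Bool × Plane

/-- The number of points of the configuration in `B`. -/
def Ground.count (g : Ground) (B : Set Plane) : ℕ∞ :=
  Set.encard {k | (g k).1 = true ∧ (g k).2 ∈ B}

/-- Translation of all the points by `t`. -/
def Ground.shift (t : Plane) (g : Ground) : Ground := fun k => ((g k).1, (g k).2 + t)

/-- `Q` is the law of (an enumeration of) a stationary hard-core point process of intensity `lamP`
and clearance `δ`. Stationarity is that of the finite-dimensional distributions of the counting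
measure, so that it does not refer to the labels. -/
structure IsHardCoreProcess (Q : Measure Ground) (lamP δ : ℝ) : Prop where
  isProbabilityMeasure : IsProbabilityMeasure Q
  stationary : ∀ (t : Plane) (n : ℕ) (B : Fin n → Set Plane), (∀ i, MeasurableSet (B i)) →
    Q.map (fun g i => (g.shift t).count (B i)) = Q.map (fun g i => g.count (B i))
  intensity : ∀ B : Set Plane, MeasurableSet B →
    ∫⁻ g, (g.count B : ℝ≥0∞) ∂Q = ENNReal.ofReal lamP * volume B
  clearance : ∀ᵐ g ∂Q, ∀ j k, j ≠ k → (g j).1 = true → (g k).1 = true → δ ≤ dist (g j).2 (g k).2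

/-! ### The marks of the clusters -/

instance permMeasurableSpace (n : ℕ) : MeasurableSpace (Equiv.Perm (Fin n)) := ⊤

/-- Positions of the caching users and of the requesting users, relative to the cluster centre. Only
as many entries as there are users are in use. -/
abbrev Positions : Type := (ℕ → Plane) × (ℕ → Plane)

/-- The mark of a cluster, in this order: the numbers of caching and of requesting users; the stored
videos and the requested videos; the positions of the users and the gains `|g|²` between caching
user `j` and requesting user `i`; the random choices of the strategy (for each request `i` a uniform
element of each set `{0, …, n}`, to choose a source, and for each `n` a uniform permutation of
`{0, …, n - 1}`, to schedule the requests); the positions of the fictitious transmitters that fill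
the idle slots. -/
abbrev Mark (L M : ℕ) : Type :=
  (ℕ × ℕ) × ((ℕ → Fin M → Fin L) × (ℕ → Fin L)) × (Positions × (ℕ × ℕ → ℝ≥0)) ×
    ((ℕ → (n : ℕ) → Fin (n + 1)) × ((n : ℕ) → Equiv.Perm (Fin n))) × (ℕ → Plane)

namespace Mark

variable {L M : ℕ} (m : Mark L M)

/-- Number of caching users. -/
def Nu : ℕ := m.1.1
/-- Number of requesting users. -/
def Nr : ℕ := m.1.2
/-- The videos stored by user `j`. -/
def cached (j : ℕ) : Fin M → Fin L := m.2.1.1 j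
/-- The video requested by user `i`. -/
def requested (i : ℕ) : Fin L := m.2.1.2 i
/-- Position of caching user `j`, relative to the centre. -/
def S (j : ℕ) : Plane := m.2.2.1.1.1 j
/-- Position of requesting user `i`, relative to the centre. -/
def D (i : ℕ) : Plane := m.2.2.1.1.2 i
/-- The gain `|g|²` from caching user `j` to requesting user `i`. -/
def gain (j i : ℕ) : ℝ≥0 := m.2.2.1.2 (j, i)
/-- A uniform element of `{0, …, n}`, for request `i`. -/
def pick (i n : ℕ) : ℕ := (m.2.2.2.1.1 i n : ℕ)
/-- A uniform permutation of `{0, …, n - 1}`. -/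
def perm (n : ℕ) : Equiv.Perm (Fin n) := m.2.2.2.1.2 n
/-- Position of the fictitious transmitter of slot `t`, relative to the centre. -/
def fict (t : ℕ) : Plane := m.2.2.2.2 t

end Mark

namespace D2DParams

variable {L M : ℕ} (p : D2DParams L M)

/-- The uniform distribution on the disc of radius `Rc` about the origin. -/
def unifDisc : Measure Plane := (volume : Measure Plane)[|Metric.ball 0 p.Rc]

instance isProbabilityMeasure_unifDisc : IsProbabilityMeasure p.unifDisc :=
  cond_isProbabilityMeasure_of_finite (Metric.measure_ball_pos volume 0 p.Rc_pos).ne'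
    measure_ball_lt_top.ne

/-- Given the positions, the gains between the users of a cluster are independent, and the law of
each depends on the distance. -/
def gainKernel : Kernel Positions (ℕ × ℕ → ℝ≥0) where
  toFun q := Measure.infinitePi fun ji : ℕ × ℕ => p.gainLaw (nndist (q.1 ji.1) (q.2 ji.2))
  measurable' := by
    refine Measurable.measure_of_isPiSystem_of_isProbabilityMeasure
      (generateFrom_squareCylinders (α := fun _ : ℕ × ℕ => ℝ≥0)).symm
      (isPiSystem_squareCylinders (fun _ => MeasurableSpace.isPiSystem_measurableSet) (by simp)) ?_
    rintro _ ⟨s, t, ht, rfl⟩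
    have ht' : ∀ i, MeasurableSet (t i) := fun i => ht i (Set.mem_univ i)
    have h (q : Positions) : Measure.infinitePi
        (fun ji : ℕ × ℕ => p.gainLaw (nndist (q.1 ji.1) (q.2 ji.2))) ((s : Set (ℕ × ℕ)).pi t) =
        ∏ ji ∈ s, p.gainLaw (nndist (q.1 ji.1) (q.2 ji.2)) (t ji) :=
      Measure.infinitePi_pi (fun ji : ℕ × ℕ => p.gainLaw (nndist (q.1 ji.1) (q.2 ji.2)))
        (fun i _ => ht' i)
    simp only [h]
    refine Finset.measurable_prod _ fun ji _ => ?_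
    exact (Kernel.measurable_coe p.gainLaw (ht' ji)).comp (by fun_prop)

instance isMarkovKernel_gainKernel : IsMarkovKernel p.gainKernel :=
  ⟨fun q => inferInstanceAs (IsProbabilityMeasure
    (Measure.infinitePi fun ji : ℕ × ℕ => p.gainLaw (nndist (q.1 ji.1) (q.2 ji.2))))⟩

/-- Law of the numbers of users: independent Poisson variables. -/
def countLaw : Measure (ℕ × ℕ) :=
  (poissonMeasure (p.lamU * (Real.pi * p.Rc ^ 2)).toNNReal).prod
    (poissonMeasure (p.lamR * (Real.pi * p.Rc ^ 2)).toNNReal)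

/-- Law of the stored and the requested videos: all independent. -/
def videoLaw : Measure ((ℕ → Fin M → Fin L) × (ℕ → Fin L)) :=
  (Measure.infinitePi fun _ : ℕ => Measure.pi fun _ : Fin M => p.pA.toMeasure).prod
    (Measure.infinitePi fun _ : ℕ => p.pV.toMeasure)

/-- Law of the positions: independent and uniform on the disc. -/
def positionLaw : Measure Positions :=
  (Measure.infinitePi fun _ : ℕ => p.unifDisc).prod (Measure.infinitePi fun _ : ℕ => p.unifDisc)

/-- Law of the random choices of the strategy: independent and uniform. -/
def choiceLaw : Measure ((ℕ → (n : ℕ) → Fin (n + 1)) × ((n : ℕ) → Equiv.Perm (Fin n))) :=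
  (Measure.infinitePi fun _ : ℕ => Measure.infinitePi fun n : ℕ =>
    (PMF.uniformOfFintype (Fin (n + 1))).toMeasure).prod
  (Measure.infinitePi fun n : ℕ => (PMF.uniformOfFintype (Equiv.Perm (Fin n))).toMeasure)

/-- Law of the mark of a cluster. -/
def markLaw : Measure (Mark L M) :=
  p.countLaw.prod (p.videoLaw.prod ((p.positionLaw ⊗ₘ p.gainKernel).prod
    (choiceLaw.prod (Measure.infinitePi fun _ : ℕ => p.unifDisc))))

instance isProbabilityMeasure_markLaw : IsProbabilityMeasure p.markLaw := by
  unfold markLaw countLaw videoLaw positionLaw choiceLaw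
  infer_instance

end D2DParams

/-! ### The marked network and its Palm distribution -/

/-- A transmitter of a cluster: the caching user `j` (`inl j`), or the fictitious transmitter of the
idle slot `t` (`inr t`). -/
abbrev Source : Type := ℕ ⊕ ℕ

/-- A realization of the network: the labelled cluster centres, their marks, and the fading
coefficients `|h|²` from transmitter `c` of cluster `k'` to requesting user `i` of cluster `k`, at
index `((k', c), (k, i))`. -/
abbrev Network (L M : ℕ) : Type :=
  Ground × (ℕ → Mark L M) × ((ℕ × Source) × (ℕ × ℕ) → ℝ≥0)

namespace Network

variable {L M : ℕ} (ω : Network L M)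

/-- Label `k` is in use. -/
def Present (k : ℕ) : Prop := (ω.1 k).1 = true
/-- The centre of cluster `k`. -/
def center (k : ℕ) : Plane := (ω.1 k).2
/-- The mark of cluster `k`. -/
def mark (k : ℕ) : Mark L M := ω.2.1 k
/-- Fading from transmitter `c` of cluster `k'` to requesting user `i` of cluster `k`. -/
def fading (k' : ℕ) (c : Source) (k i : ℕ) : ℝ≥0 := ω.2.2 ((k', c), (k, i))
/-- Translation of the network by `t`. -/
def shift (t : Plane) : Network L M := (Ground.shift t ω.1, ω.2)

end Network

/-- The unit square. -/
def unitSquare : Set Plane := {x | ∀ i, x i ∈ Set.Ico (0 : ℝ) 1}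

namespace D2DParams

variable {L M : ℕ} (p : D2DParams L M)

/-- Law of the network when the cluster centres have law `Q`: the marks are i.i.d. and independent
of the centres, and the fading coefficients are i.i.d. and independent of everything. -/
def networkLaw (Q : Measure Ground) : Measure (Network L M) :=
  Q.prod ((Measure.infinitePi fun _ : ℕ => p.markLaw).prod
    (Measure.infinitePi fun _ : (ℕ × Source) × (ℕ × ℕ) => p.fadingLaw))

/-- The Palm distribution of the network, as a law on pairs of a label `k` and a realization in
which cluster `k` has its centre at the origin: a cluster is picked among those with centre in the
unit square, the network is seen from there, and the result is normalized by the intensity. -/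
def palm (Q : Measure Ground) (lamP : ℝ) : Measure (ℕ × Network L M) :=
  (ENNReal.ofReal lamP)⁻¹ • Measure.sum fun k =>
    ((p.networkLaw Q).restrict {ω | ω.Present k ∧ ω.center k ∈ unitSquare}).map
      fun ω => (k, ω.shift (-ω.center k))

/-! ### The strategy -/

/-- The power of two just below `N`. -/
def slotsLow (N : ℕ) : ℕ := 2 ^ Nat.log 2 N

/-- The power of two just above `N`. -/
def slotsHigh (N : ℕ) : ℕ := 2 ^ Nat.clog 2 N

/-- The number of slots of a cluster with `N` matches. If `N` is a power of two this is `N`; a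
cluster without a match has one slot, which is idle. -/
def slots (N : ℕ) : ℕ :=
  if ((N : ℝ) - slotsLow N) / ((slotsHigh N : ℝ) - slotsLow N) < p.eps then slotsLow N
  else slotsHigh N

end D2DParams

namespace Mark

open scoped Classical in
/-- The caching users that store the video requested by user `i`. -/
def holders {L M : ℕ} (m : Mark L M) (i : ℕ) : Finset ℕ :=
  (Finset.range m.Nu).filter fun j => ∃ a, m.cached j a = m.requested i

/-- User `i` of the cluster has a match. -/
def Matched {L M : ℕ} (m : Mark L M) (i : ℕ) : Prop := i < m.Nr ∧ (m.holders i).Nonempty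

open scoped Classical in
/-- The number of matches `N_m`. -/
def Nm {L M : ℕ} (m : Mark L M) : ℕ := Nat.count m.Matched m.Nr

open scoped Classical in
/-- The source of request `i`: a uniform element of `holders i`, if there is one. -/
def source {L M : ℕ} (m : Mark L M) (i : ℕ) : ℕ :=
  Nat.nth (· ∈ m.holders i) (m.pick i ((m.holders i).card - 1))

end Mark

namespace D2DParams

variable {L M : ℕ} (p : D2DParams L M)

/-- The permutation that schedules the requests of a cluster. With `N` matches and `W` slots it is
uniform on the permutations of `{0, …, max N W - 1}`; it sends the rank of a matched request to its
slot, and the request is dropped if the image is at least `W`. So for `N ≤ W` the requests are put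
into random distinct slots, and for `W ≤ N` random `N - W` requests are dropped and the others are
assigned to the slots by a random permutation. -/
def schedule (m : Mark L M) : Equiv.Perm (Fin (max m.Nm (p.slots m.Nm))) := m.perm _

open scoped Classical in
/-- The value of the scheduling permutation at request `i`: its slot, if it is less than the number
of slots. -/
def slotOf (m : Mark L M) (i : ℕ) : ℕ :=
  if h : Nat.count m.Matched i < max m.Nm (p.slots m.Nm) then
    (p.schedule m ⟨Nat.count m.Matched i, h⟩ : ℕ)
  else p.slots m.Nm

/-- Request `i` has a match and is scheduled. -/
def Scheduled (m : Mark L M) (i : ℕ) : Prop := m.Matched i ∧ p.slotOf m i < p.slots m.Nm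

open scoped Classical in
/-- The transmitter that is active in slot `t` of the cluster; idle slots are filled with fictitious
transmitters. -/
def activeIn (m : Mark L M) (t : ℕ) : Source :=
  if h : t < max m.Nm (p.slots m.Nm) then
    let r : ℕ := ((p.schedule m).symm ⟨t, h⟩ : ℕ)
    if r < m.Nm then Sum.inl (m.source (Nat.nth m.Matched r)) else Sum.inr t
  else Sum.inr t

/-- Position of a transmitter relative to the centre of its cluster. -/
def sourcePos (m : Mark L M) : Source → Plane
  | Sum.inl j => m.S j
  | Sum.inr t => m.fict t

/-! ### Interference and rates -/

/-- The slots of a cluster with `w` slots that take place during slot `s` of a cluster with `n`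
slots, `n ≤ w` being powers of two. -/
def overlap (n w s : ℕ) : Finset ℕ := Finset.Ico (s * (w / n)) ((s + 1) * (w / n))

/-- How many of the slots in `overlap n w s` are used by transmitter `c`, for a cluster with mark
`m`. -/
def multiplicity (m : Mark L M) (n s : ℕ) (c : Source) : ℕ :=
  ((overlap n (p.slots m.Nm) s).filter fun t => p.activeIn m t = c).card

/-- The power, divided by `P`, that transmitter `c` of cluster `k'` produces at the point with
position `d` relative to the centre of cluster `k`, where requesting user `i` of `k` listens. -/
def received (ω : Network L M) (k' : ℕ) (c : Source) (k i : ℕ) (d : Plane) : ℝ≥0 :=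
  ω.fading k' c k i *
    p.pathLoss (nndist (ω.center k' + sourcePos (ω.mark k') c) (ω.center k + d))

/-- The time-averaged contribution, divided by `P`, of cluster `k'` to the interference during slot
`s` out of `n`. -/
def contribution (ω : Network L M) (k' k i : ℕ) (d : Plane) (n s : ℕ) : ℝ≥0 :=
  let m := ω.mark k'
  let w := p.slots m.Nm
  if w ≤ n then p.received ω k' (p.activeIn m (s * w / n)) k i d
  else if w ≤ slotsHigh p.nmax then
    ((n : ℝ≥0) / (w : ℝ≥0)) * ∑ c ∈ (overlap n w s).image (p.activeIn m),
      (p.multiplicity m n s c : ℝ≥0) * p.received ω k' c k i d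
  else 0

open scoped Classical in
/-- The interference seen by requesting user `i` of cluster `k`, at position `d` relative to the
centre, in slot `s` out of `n`. It may be infinite. -/
def interference (ω : Network L M) (k i : ℕ) (d : Plane) (n s : ℕ) : ℝ≥0∞ :=
  ∑' k', if ω.Present k' ∧ k' ≠ k then
    ENNReal.ofReal p.P * (p.contribution ω k' k i d n s : ℝ≥0∞) else 0

/-- The rate `(1 / n) log₂ (1 + P g / I)`. -/
def rate (n : ℕ) (g : ℝ≥0) (I : ℝ≥0∞) : EReal :=
  ENNReal.log (1 + ENNReal.ofReal p.P * g / I) / (((n : ℝ) * Real.log 2 : ℝ) : EReal)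

/-- The request of user `i` of cluster `k` is served: it has a match, it is scheduled, and the
attempted rate is below the achievable rate. -/
def Served (ω : Network L M) (k i : ℕ) : Prop :=
  p.Scheduled (ω.mark k) i ∧
    (p.R : EReal) < p.rate (p.slots (ω.mark k).Nm) ((ω.mark k).gain ((ω.mark k).source i) i)
      (p.interference ω k i ((ω.mark k).D i) (p.slots (ω.mark k).Nm) (p.slotOf (ω.mark k) i))

/-! ### The metrics -/

open scoped Classical in
/-- The number of served requests of cluster `k`. -/
def Nsc (ω : Network L M) (k : ℕ) : ℝ≥0∞ :=
  ∑ i ∈ Finset.range (ω.mark k).Nr, if p.Served ω k i then 1 else 0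

open scoped Classical in
/-- The number of served requests of users in `K`. -/
def Ns (K : Set Plane) (ω : Network L M) : ℝ≥0∞ :=
  ∑' k, if ω.Present k then
    ∑ i ∈ Finset.range (ω.mark k).Nr,
      if ω.center k + (ω.mark k).D i ∈ K ∧ p.Served ω k i then 1 else 0
  else 0

/-- The local metric: the ratio of the mean number of served requests to the mean number of requests
in the typical cluster. -/
def localMetric (Q : Measure Ground) (lamP : ℝ) : ℝ≥0∞ :=
  (∫⁻ z, p.Nsc z.2 z.1 ∂p.palm Q lamP) / ∫⁻ z, ((z.2.mark z.1).Nr : ℝ≥0∞) ∂p.palm Q lamP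

/-- The global metric: the ratio of the mean number of served requests in `K` to the mean number
`lamR * |K|` of requests in `K`. -/
def globalMetric (Q : Measure Ground) (K : Set Plane) : ℝ≥0∞ :=
  (∫⁻ ω, p.Ns K ω ∂p.networkLaw Q) / (ENNReal.ofReal p.lamR * volume K)

open scoped Classical in
/-- The average rate. In a cluster where nothing is scheduled all summands are `0 / 0 = 0`. -/
def averageRate (Q : Measure Ground) (lamP : ℝ) : ℝ≥0∞ :=
  ENNReal.ofReal p.R * ∫⁻ z, ∑ i ∈ Finset.range (z.2.mark z.1).Nr,
    (if p.Served z.2 z.1 i then (1 : ℝ≥0∞) else 0) /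
      (∑ j ∈ Finset.range (z.2.mark z.1).Nr,
        if p.Scheduled (z.2.mark z.1) j then (1 : ℝ≥0∞) else 0) ∂p.palm Q lamP

/-! ### The success probability of a transmission -/

/-- The complementary cumulative distribution function, at `t`, of the gain `|g|²` between a source
at `s` and a destination at `d`. -/
def gainCcdf (s d : Plane) (t : ℝ≥0∞) : ℝ≥0∞ := p.gainLaw (nndist s d) {g | t < (g : ℝ≥0∞)}

/-- The conditional probability, given the network around cluster `k` and its number of slots `n`,
that a transmission in slot `s` from a source to a destination, both uniform on the disc, achieves
the rate `R`: the function `gainCcdf` at `I (2 ^ (n R) - 1) / P`, averaged over source and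
destination. -/
def success (ω : Network L M) (k n s : ℕ) : ℝ≥0∞ :=
  ∫⁻ S, ∫⁻ D, p.gainCcdf S D
    (p.interference ω k 0 D n s * ENNReal.ofReal ((2 : ℝ) ^ ((n : ℝ) * p.R) - 1) /
      ENNReal.ofReal p.P) ∂p.unifDisc ∂p.unifDisc

/-- The number of scheduled requests of a cluster with `N` matches. -/
def numScheduled (N : ℕ) : ℕ := if p.slots N = slotsHigh N then N else slotsLow N

end D2DParams

end

/-!
Whether a request is scheduled, by which source and in which slot, is decided by the numbers of
users, the videos and the random choices of the cluster alone. These are independent of the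
positions and the gains, so that the source and the destination of a scheduled request can be
replaced by fresh uniform points `S`, `D` with a fresh gain (`lintegral_markLaw_fresh`). The
interference at the cluster involves only the marks of the other clusters and the fading, and is
independent of the mark of the cluster (`rowInterference_withMark`). Integrating out the gain first
turns the event of service into the complementary cdf of the gain at a threshold (`lt_rate_iff`).

The interference is still evaluated in the slot of the request. A permutation of the slots of an
interfering cluster, acting on its scheduling permutation, its fictitious transmitters and their
fading, preserves all the laws and exchanges any two slots of the listening cluster. Hence the law
of the interference does not depend on the slot (`lintegral_rowInterference_slot`), and every
scheduled request has the same conditional probability of success, `successAt`. Their number is a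
function of the number of matches (`sum_scheduled`). This gives the local metric and the average
rate, as integrals with different weights (`lintegral_palm_served_eq_success`).

For the global metric, fix the relative position `D` of the user. The centres of the clusters,
weighted by `successAt`, have an intensity measure which is a multiple of the area, by stationarity
(`lintegral_successCount`). Stationarity is given only for counts of sets, whereas `successAt` is a
functional of the labelled configuration. The hard-core property bridges the gap: in a partition of
the plane into cells of diameter less than the clearance, each cell has at most one centre, so that
labelling the centres by their cells gives a canonical labelling whose finite-dimensional events are
events about counts (`map_canon_shift`), and the interference does not depend on the labelling, in
law (`lintegral_rowInterference_relabel`).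
-/

/-! ### Infinite product measures -/

section InfinitePi

variable {ι : Type*} {X Y : Type*} [MeasurableSpace X] [MeasurableSpace Y]

/-- Pairing two independent families of independent variables. -/
theorem infinitePi_prod_map_pair (μ : ι → Measure X) (ν : ι → Measure Y)
    [∀ i, IsProbabilityMeasure (μ i)] [∀ i, IsProbabilityMeasure (ν i)] :
    ((Measure.infinitePi μ).prod (Measure.infinitePi ν)).map (fun z i => (z.1 i, z.2 i)) =
      Measure.infinitePi fun i => (μ i).prod (ν i) := by
  refine Measure.eq_infinitePi _ fun s t ht => ?_
  have hm : Measurable fun (z : (ι → X) × (ι → Y)) i => (z.1 i, z.2 i) := by fun_prop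
  have hs : MeasurableSet ((s : Set ι).pi t) := .pi s.countable_toSet fun i _ => ht i
  rw [Measure.map_apply hm hs, Measure.prod_apply (hm hs)]
  have h (x : ι → X) : Measure.infinitePi ν
      (Prod.mk x ⁻¹' ((fun (z : (ι → X) × (ι → Y)) i => (z.1 i, z.2 i)) ⁻¹' (s : Set ι).pi t)) =
      ∏ i ∈ s, ν i (Prod.mk (x i) ⁻¹' t i) :=
    Measure.infinitePi_pi (t := fun i => Prod.mk (x i) ⁻¹' t i) ν
      fun i _ => measurable_prodMk_left (ht i)
  simp only [h]
  have hmeas (i : ι) : Measurable fun a => ν i (Prod.mk a ⁻¹' t i) :=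
    measurable_measure_prodMk_left (ht i)
  have hind : iIndepFun (fun i (x : ι → X) => ν i (Prod.mk (x i) ⁻¹' t i))
      (Measure.infinitePi μ) :=
    iIndepFun_infinitePi (X := fun i a => ν i (Prod.mk a ⁻¹' t i)) fun i => (hmeas i)
  rw [lintegral_prod_eq_prod_lintegral_of_indepFun s _ hind
    fun i => (hmeas i).comp (measurable_pi_apply i)]
  refine Finset.prod_congr rfl fun i _ => ?_
  rw [Measure.prod_apply (ht i), ← Measure.infinitePi_map_eval μ i,
    lintegral_map (hmeas i) (measurable_pi_apply i)]

theorem measurable_update_prod [DecidableEq ι] (k : ι) :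
    Measurable fun z : X × (ι → X) => Function.update z.2 k z.1 := by
  refine measurable_pi_lambda _ fun i => ?_
  by_cases h : i = k
  · subst h; simpa using measurable_fst
  · simp only [Function.update_of_ne h]; fun_prop

/-- Replacing one coordinate of an independent family by an independent copy does not change the
law of the family. -/
theorem infinitePi_map_update [DecidableEq ι] (μ : ι → Measure X)
    [∀ i, IsProbabilityMeasure (μ i)] (k : ι) :
    ((μ k).prod (Measure.infinitePi μ)).map (fun z => Function.update z.2 k z.1) =
      Measure.infinitePi μ := by
  refine Measure.eq_infinitePi _ fun s t ht => ?_
  have hm := measurable_update_prod (X := X) k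
  have hs : MeasurableSet ((s : Set ι).pi t) := .pi s.countable_toSet fun i _ => ht i
  rw [Measure.map_apply hm hs]
  by_cases hk : k ∈ s
  · have : (fun z : X × (ι → X) => Function.update z.2 k z.1) ⁻¹' (s : Set ι).pi t =
        t k ×ˢ ((s.erase k : Finset ι) : Set ι).pi t := by
      ext z
      simp only [Set.mem_preimage, Set.mem_pi, Finset.mem_coe, Set.mem_prod, Finset.mem_erase]
      refine ⟨fun h => ⟨by simpa using h k hk, fun i hi => by simpa [hi.1] using h i hi.2⟩,
        fun h i hi => ?_⟩
      by_cases hik : i = k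
      · subst hik; simpa using h.1
      · simpa [hik] using h.2 i ⟨hik, hi⟩
    rw [this, Measure.prod_prod, Measure.infinitePi_pi _ fun i _ => ht i,
      Finset.mul_prod_erase s (fun i => μ i (t i)) hk]
  · have : (fun z : X × (ι → X) => Function.update z.2 k z.1) ⁻¹' (s : Set ι).pi t =
        Set.univ ×ˢ (s : Set ι).pi t := by
      ext z
      simp only [Set.mem_preimage, Set.mem_pi, Finset.mem_coe, Set.mem_prod, Set.mem_univ, true_and]
      refine forall₂_congr fun i hi => ?_
      rw [Function.update_of_ne (by rintro rfl; exact hk hi)]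
    rw [this, Measure.prod_prod, Measure.infinitePi_pi _ fun i _ => ht i]
    simp

end InfinitePi

/-! ### Measurability through countably many values -/

/-- A function that is measurable once a discrete quantity `h a` is frozen is measurable. The
σ-algebra `⊤` is written out because types such as `Finset ℕ` carry none by default. -/
theorem measurable_of_countable_cases {α β ι : Type*} [MeasurableSpace α] [MeasurableSpace β]
    [Countable ι] {h : α → ι} (hh : Measurable[_, ⊤] h) {F : ι → α → β}
    (hF : ∀ i, Measurable (F i)) : Measurable fun a => F (h a) a := by
  let _ : MeasurableSpace ι := ⊤
  have : Measurable fun q : ι × α => F q.1 q.2 :=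
    measurable_from_prod_countable_right hF
  exact this.comp (hh.prodMk measurable_id)

/-- A map into a countable type is measurable for the discrete σ-algebra when all of its fibres
are measurable. -/
theorem measurable_top_of_fibre {α ι : Type*} [MeasurableSpace α] [Countable ι] {h : α → ι}
    (hh : ∀ i, MeasurableSet {a | h a = i}) : Measurable[_, ⊤] h := by
  let _ : MeasurableSpace ι := ⊤
  exact measurable_to_countable' hh

theorem measurable_top_finset {α ι : Type*} [MeasurableSpace α] [Countable ι] {h : α → Finset ι}
    (hh : ∀ i, MeasurableSet {a | i ∈ h a}) : Measurable[_, ⊤] h := by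
  refine measurable_top_of_fibre fun s => ?_
  have : {a | h a = s} = ⋂ i, {a | i ∈ h a ↔ i ∈ s} := by
    ext a; simp [Finset.ext_iff]
  rw [this]
  refine MeasurableSet.iInter fun i => ?_
  by_cases hi : i ∈ s
  · simpa [hi] using hh i
  · have : {a | i ∈ h a ↔ i ∈ s} = {a | i ∈ h a}ᶜ := by ext a; simp [hi]
    exact this ▸ (hh i).compl

theorem measurable_top_bind {α ι κ : Type*} [MeasurableSpace α] [Countable ι] {h : α → ι}
    (hh : Measurable[_, ⊤] h) {F : ι → α → κ} (hF : ∀ i, Measurable[_, ⊤] (F i)) :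
    Measurable[_, ⊤] fun a => F (h a) a := by
  let _ : MeasurableSpace κ := ⊤
  exact measurable_of_countable_cases hh hF

theorem measurable_top_comp {α ι κ : Type*} [MeasurableSpace α] {h : α → ι}
    (hh : Measurable[_, ⊤] h) (f : ι → κ) : Measurable[_, ⊤] fun a => f (h a) :=
  Measurable.comp (@measurable_from_top _ _ ⊤ f) hh

/-! ### Measurability of the functionals of a mark -/

namespace Mark

variable {L M : ℕ}

theorem measurable_Nu : Measurable (Nu : Mark L M → ℕ) := by unfold Nu; fun_prop
theorem measurable_Nr : Measurable (Nr : Mark L M → ℕ) := by unfold Nr; fun_prop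
theorem measurable_S (j : ℕ) : Measurable fun m : Mark L M => m.S j := by unfold S; fun_prop
theorem measurable_D (i : ℕ) : Measurable fun m : Mark L M => m.D i := by unfold D; fun_prop
theorem measurable_gain (j i : ℕ) : Measurable fun m : Mark L M => m.gain j i := by
  unfold gain; fun_prop
theorem measurable_fict (t : ℕ) : Measurable fun m : Mark L M => m.fict t := by
  unfold fict; fun_prop
theorem measurable_perm (n : ℕ) : Measurable fun m : Mark L M => m.perm n := by
  unfold perm; fun_prop
theorem measurable_pick (i n : ℕ) : Measurable fun m : Mark L M => m.pick i n := by
  unfold pick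
  exact (measurable_of_countable (fun a : Fin (n + 1) => (a : ℕ))).comp (by fun_prop)

theorem measurableSet_stores (j i : ℕ) :
    MeasurableSet {m : Mark L M | ∃ a, m.cached j a = m.requested i} := by
  have : {m : Mark L M | ∃ a, m.cached j a = m.requested i} =
      ⋃ a, {m | m.cached j a = m.requested i} := by ext; simp
  rw [this]
  refine MeasurableSet.iUnion fun a => measurableSet_eq_fun ?_ ?_
  · unfold cached; fun_prop
  · unfold requested; fun_prop

theorem measurable_holders (i : ℕ) : Measurable[_, ⊤] fun m : Mark L M => m.holders i := by
  refine measurable_top_finset fun j => ?_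
  simp only [holders, Finset.mem_filter, Finset.mem_range]
  exact (measurableSet_lt measurable_const measurable_Nu).inter (measurableSet_stores j i)

open scoped Classical in
/-- The matched requests of a cluster. -/
noncomputable def matchedSet (m : Mark L M) : Finset ℕ := (Finset.range m.Nr).filter m.Matched

theorem mem_matchedSet (m : Mark L M) (i : ℕ) : i ∈ m.matchedSet ↔ m.Matched i := by
  simp only [matchedSet, Finset.mem_filter, Finset.mem_range, Matched]; tauto

theorem matched_eq (m : Mark L M) : m.Matched = (· ∈ m.matchedSet) :=
  funext fun i => propext (m.mem_matchedSet i).symm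

theorem measurableSet_matched (i : ℕ) : MeasurableSet {m : Mark L M | m.Matched i} :=
  (measurableSet_lt measurable_const measurable_Nr).inter
    (measurable_holders i (t := {s : Finset ℕ | s.Nonempty}) trivial)

theorem measurable_matchedSet : Measurable[_, ⊤] fun m : Mark L M => m.matchedSet := by
  refine measurable_top_finset fun i => ?_
  simpa only [mem_matchedSet] using measurableSet_matched i

theorem Nm_eq_card (m : Mark L M) : m.Nm = m.matchedSet.card := by
  classical
  exact Nat.count_eq_card_filter_range _ _

theorem measurable_Nm : Measurable (Nm : Mark L M → ℕ) := by
  have : (Nm : Mark L M → ℕ) = fun m => m.matchedSet.card := funext Nm_eq_card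
  rw [this]
  exact measurable_top_comp measurable_matchedSet Finset.card

open scoped Classical in
theorem measurable_rank (i : ℕ) : Measurable fun m : Mark L M => Nat.count m.Matched i := by
  have : (fun m : Mark L M => Nat.count m.Matched i) =
      fun m => ((Finset.range i).filter (· ∈ m.matchedSet)).card := by
    funext m
    simp only [Nat.count_eq_card_filter_range, mem_matchedSet]
  rw [this]
  exact measurable_top_comp measurable_matchedSet
    fun A => ((Finset.range i).filter (· ∈ A)).card

theorem measurable_nth_matched (r : ℕ) :
    Measurable fun m : Mark L M => Nat.nth m.Matched r := by
  simp only [matched_eq]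
  exact measurable_top_comp measurable_matchedSet fun A => Nat.nth (· ∈ A) r

theorem measurable_source (i : ℕ) : Measurable fun m : Mark L M => m.source i :=
  measurable_of_countable_cases (measurable_holders i)
    (F := fun A m => Nat.nth (· ∈ A) (m.pick i (A.card - 1)))
    fun A => (measurable_from_nat (f := Nat.nth (· ∈ A))).comp (measurable_pick i _)

end Mark

namespace D2DParams

variable {L M : ℕ} (p : D2DParams L M)

theorem measurable_slotOf (i : ℕ) : Measurable fun m : Mark L M => p.slotOf m i := by
  classical
  refine measurable_of_countable_cases (ι := ℕ × ℕ) (β := ℕ)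
    (h := fun m : Mark L M => (m.Nm, Nat.count m.Matched i))
    (F := fun q m => if h : q.2 < max q.1 (p.slots q.1) then (m.perm _ ⟨q.2, h⟩ : ℕ)
      else p.slots q.1) ?_ fun q => ?_
  · refine measurable_top_of_fibre fun q => ?_
    exact (Mark.measurable_Nm.prodMk (Mark.measurable_rank i)) (measurableSet_singleton q)
  · by_cases h : q.2 < max q.1 (p.slots q.1)
    · simp only [h, dite_true]
      exact (@measurable_from_top _ _ _ fun σ : Equiv.Perm (Fin (max q.1 (p.slots q.1))) =>
        (σ ⟨q.2, h⟩ : ℕ)).comp (Mark.measurable_perm _)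
    · simp only [h, dite_false]; exact measurable_const

theorem measurableSet_scheduled (i : ℕ) : MeasurableSet {m : Mark L M | p.Scheduled m i} :=
  (Mark.measurableSet_matched i).inter (measurableSet_lt (p.measurable_slotOf i)
    ((measurable_from_nat (f := p.slots)).comp Mark.measurable_Nm))

theorem measurable_activeIn (t : ℕ) :
    Measurable[_, ⊤] fun m : Mark L M => p.activeIn m t := by
  classical
  refine measurable_top_bind (ι := ℕ) (h := Mark.Nm)
    (F := fun N m => if h : t < max N (p.slots N) then
      if (((m.perm _).symm ⟨t, h⟩ : Fin _) : ℕ) < N then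
        Sum.inl (m.source (Nat.nth m.Matched (((m.perm _).symm ⟨t, h⟩ : Fin _) : ℕ)))
      else Sum.inr t
    else Sum.inr t) Mark.measurable_Nm fun N => ?_
  by_cases h : t < max N (p.slots N)
  · simp only [h, dite_true]
    refine measurable_top_bind (h := fun m : Mark L M =>
        (((m.perm _).symm ⟨t, h⟩ : Fin (max N (p.slots N))) : ℕ))
      (F := fun r m => if r < N then Sum.inl (m.source (Nat.nth m.Matched r)) else Sum.inr t)
      ?_ fun r => ?_
    · exact (@measurable_from_top _ _ _ fun σ : Equiv.Perm (Fin (max N (p.slots N))) =>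
        ((σ.symm ⟨t, h⟩ : Fin _) : ℕ)).comp (Mark.measurable_perm _)
    · by_cases hr : r < N
      · simp only [hr, if_true]
        refine measurable_top_comp (h := fun m : Mark L M => m.source (Nat.nth m.Matched r)) ?_ _
        exact measurable_of_countable_cases (Mark.measurable_nth_matched r)
          (F := fun q m => m.source q) Mark.measurable_source
      · simp only [hr, if_false]; exact @measurable_const _ _ ⊤ _ _
  · simp only [h, dite_false]; exact @measurable_const _ _ ⊤ _ _

theorem measurable_sourcePos (c : Source) : Measurable fun m : Mark L M => sourcePos m c := by
  cases c with
  | inl j => exact Mark.measurable_S j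
  | inr t => exact Mark.measurable_fict t

end D2DParams

/-! ### The contribution of one cluster to the interference -/

/-- The part of the randomness of an interfering cluster that one listener is exposed to: the mark,
and the fading coefficients from the transmitters of the cluster to this listener. -/
abbrev Row (L M : ℕ) : Type := Mark L M × (Source → ℝ≥0)

namespace D2DParams

variable {L M : ℕ} (p : D2DParams L M)

/-- The law of a row. -/
noncomputable def rowLaw : Measure (Row L M) :=
  p.markLaw.prod (Measure.infinitePi fun _ : Source => p.fadingLaw)

instance isProbabilityMeasure_rowLaw : IsProbabilityMeasure p.rowLaw := by
  unfold rowLaw; infer_instance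

/-- The slots of a cluster with `w` slots that take place during, or contain, slot `s` of a
cluster with `n` slots. -/
def activeSlots (n w s : ℕ) : Finset ℕ := if w ≤ n then {s * w / n} else overlap n w s

/-- The weight of each slot in `activeSlots n w s` in the time average. -/
noncomputable def slotWeight (n w : ℕ) : ℝ≥0 :=
  if w ≤ n then 1 else if w ≤ slotsHigh p.nmax then (n : ℝ≥0) / (w : ℝ≥0) else 0

/-- The contribution of a cluster centred at `x` to the interference in slot `s` out of `n` for a
listener at `d`, with the sum over transmitters written as a sum over slots. -/
noncomputable def rowContribution (y : Row L M) (x d : Plane) (n s : ℕ) : ℝ≥0 :=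
  p.slotWeight n (p.slots y.1.Nm) * ∑ t ∈ activeSlots n (p.slots y.1.Nm) s,
    y.2 (p.activeIn y.1 t) *
      p.pathLoss (nndist (x + sourcePos y.1 (p.activeIn y.1 t)) d)

theorem contribution_eq (ω : Network L M) (k' k i : ℕ) (d : Plane) (n s : ℕ) :
    p.contribution ω k' k i d n s =
      p.rowContribution (ω.mark k', fun c => ω.fading k' c k i) (ω.center k')
        (ω.center k + d) n s := by
  simp only [contribution, rowContribution, slotWeight, activeSlots, received]
  split_ifs with h1 h2
  · simp
  · congr 1
    have := Finset.sum_comp (s := overlap n (p.slots (ω.mark k').Nm) s)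
      (fun c => ω.fading k' c k i *
        p.pathLoss (nndist (ω.center k' + sourcePos (ω.mark k') c) (ω.center k + d)))
      (fun t => p.activeIn (ω.mark k') t)
    rw [this]
    refine Finset.sum_congr rfl fun c _ => ?_
    rw [nsmul_eq_mul]
    rfl
  · simp

theorem measurable_rowContribution (n s : ℕ) :
    Measurable fun q : Row L M × Plane × Plane => p.rowContribution q.1 q.2.1 q.2.2 n s := by
  refine measurable_of_countable_cases (h := fun q : Row L M × Plane × Plane => q.1.1.Nm)
    (F := fun N q => p.slotWeight n (p.slots N) * ∑ t ∈ activeSlots n (p.slots N) s,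
      q.1.2 (p.activeIn q.1.1 t) *
        p.pathLoss (nndist (q.2.1 + sourcePos q.1.1 (p.activeIn q.1.1 t)) q.2.2))
    (Mark.measurable_Nm.comp (measurable_fst.comp measurable_fst)) fun N => ?_
  refine Measurable.const_mul (Finset.measurable_sum _ fun t _ => ?_) _
  refine measurable_of_countable_cases
    (h := fun q : Row L M × Plane × Plane => p.activeIn q.1.1 t)
    (F := fun c q => q.1.2 c * p.pathLoss (nndist (q.2.1 + sourcePos q.1.1 c) q.2.2))
    ((p.measurable_activeIn t).comp (measurable_fst.comp measurable_fst)) fun c => ?_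
  have h1 : Measurable fun q : Row L M × Plane × Plane => sourcePos q.1.1 c :=
    (measurable_sourcePos c).comp (measurable_fst.comp measurable_fst)
  have h2 := p.measurable_pathLoss
  fun_prop

theorem measurable_rowContribution_comp {α : Type*} [MeasurableSpace α] {f : α → Row L M}
    {g h : α → Plane} (hf : Measurable f) (hg : Measurable g) (hh : Measurable h) (n s : ℕ) :
    Measurable fun a => p.rowContribution (f a) (g a) (h a) n s := by
  have h1 : Measurable fun a => (f a, g a, h a) := hf.prodMk (hg.prodMk hh)
  have h2 := Measurable.comp (p.measurable_rowContribution n s) h1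
  simpa only [Function.comp_def] using h2

/-! ### The law of a contribution does not depend on the slot -/

theorem one_le_slots (N : ℕ) : 1 ≤ p.slots N := by
  unfold slots slotsLow slotsHigh
  split_ifs <;> exact Nat.one_le_two_pow

theorem activeSlots_lt {n w s t : ℕ} (hw : 1 ≤ w) (hs : s < n) (ht : t ∈ activeSlots n w s) :
    t < w := by
  unfold activeSlots overlap at ht
  split_ifs at ht with h
  · rw [Finset.mem_singleton] at ht
    rw [ht, Nat.div_lt_iff_lt_mul (by omega)]
    nlinarith
  · rw [Finset.mem_Ico] at ht
    calc t < (s + 1) * (w / n) := ht.2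
      _ ≤ n * (w / n) := Nat.mul_le_mul_right _ hs
      _ ≤ w := Nat.mul_div_le w n

theorem card_activeSlots (n w s s' : ℕ) :
    (activeSlots n w s).card = (activeSlots n w s').card := by
  unfold activeSlots overlap
  split_ifs
  · simp
  · simp [Nat.add_mul]

/-- A set of slots is carried onto another one of the same size by a permutation of the slots. -/
theorem exists_perm_image_eq {Z : ℕ} {A B : Finset ℕ} (hA : ∀ t ∈ A, t < Z) (hB : ∀ t ∈ B, t < Z)
    (h : A.card = B.card) :
    ∃ τ : Equiv.Perm (Fin Z), B.image (τ.extendDomain Fin.equivSubtype) = A := by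
  classical
  have key (C : Finset ℕ) (hC : ∀ t ∈ C, t < Z) :
      Fintype.card {x : Fin Z // (x : ℕ) ∈ C} = C.card := by
    rw [← Fintype.card_coe]
    exact Fintype.card_congr
      { toFun := fun x => ⟨x.1, x.2⟩
        invFun := fun t => ⟨⟨t.1, hC t.1 t.2⟩, t.2⟩
        left_inv := fun _ => rfl
        right_inv := fun _ => rfl }
  let e : {x : Fin Z // (x : ℕ) ∈ B} ≃ {x : Fin Z // (x : ℕ) ∈ A} :=
    Fintype.equivOfCardEq (by rw [key A hA, key B hB, h])
  refine ⟨e.extendSubtype, Finset.eq_of_subset_of_card_le ?_ ?_⟩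
  · intro t ht
    obtain ⟨u, hu, rfl⟩ := Finset.mem_image.1 ht
    have h1 := Equiv.Perm.extendDomain_apply_image e.extendSubtype
      (Fin.equivSubtype (n := Z)) ⟨u, hB u hu⟩
    have h2 : ((Fin.equivSubtype (n := Z) ⟨u, hB u hu⟩ : {i // i < Z}) : ℕ) = u := rfl
    rw [h2] at h1
    rw [h1]
    exact e.extendSubtype_mem ⟨u, hB u hu⟩ hu
  · rw [Finset.card_image_of_injective _ (Equiv.injective _), h]

/-- Relabelling of the transmitters of a cluster along a permutation of its slots: the fictitious
transmitters move with their slots. -/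
def relabel (π : Equiv.Perm ℕ) : Equiv.Perm Source := Equiv.sumCongr (Equiv.refl ℕ) π

/-- The action on rows of a permutation of the slots (one for each size of the scheduling
permutation, and `π` for the fictitious transmitters). -/
def permuteSlots (τ : ∀ n, Equiv.Perm (Fin n)) (π : Equiv.Perm ℕ) (y : Row L M) : Row L M :=
  ((y.1.1, y.1.2.1, y.1.2.2.1, (y.1.2.2.2.1.1, fun n => τ n * y.1.2.2.2.1.2 n),
    fun t => y.1.2.2.2.2 (π.symm t)), fun c => y.2 ((relabel π).symm c))

theorem measurePreserving_mul_uniform {n : ℕ} (τ : Equiv.Perm (Fin n)) :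
    MeasurePreserving (fun σ => τ * σ)
      (PMF.uniformOfFintype (Equiv.Perm (Fin n))).toMeasure
      (PMF.uniformOfFintype (Equiv.Perm (Fin n))).toMeasure := by
  have : MeasurableSingletonClass (Equiv.Perm (Fin n)) := ⟨fun _ => trivial⟩
  refine ⟨measurable_from_top, ?_⟩
  refine Measure.ext_of_singleton fun σ => ?_
  have h : (fun σ => τ * σ) ⁻¹' {σ} = {τ⁻¹ * σ} := by
    ext x; simp [eq_inv_mul_iff_mul_eq]
  rw [Measure.map_apply measurable_from_top (measurableSet_singleton σ), h,
    PMF.toMeasure_apply_singleton _ _ (measurableSet_singleton _),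
    PMF.toMeasure_apply_singleton _ _ (measurableSet_singleton _)]
  simp

/-- Left multiplication preserves the uniform law on permutations, and a permutation of the indices
preserves the law of an i.i.d. family. -/
theorem measurePreserving_permuteSlots (τ : ∀ n, Equiv.Perm (Fin n)) (π : Equiv.Perm ℕ) :
    MeasurePreserving (permuteSlots τ π) p.rowLaw p.rowLaw := by
  have h1 : MeasurePreserving (fun σ : ∀ n, Equiv.Perm (Fin n) => fun n => τ n * σ n)
      (Measure.infinitePi fun n : ℕ => (PMF.uniformOfFintype (Equiv.Perm (Fin n))).toMeasure)
      (Measure.infinitePi fun n : ℕ => (PMF.uniformOfFintype (Equiv.Perm (Fin n))).toMeasure) := by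
    refine ⟨measurable_pi_lambda _ fun n => measurable_from_top.comp (measurable_pi_apply n), ?_⟩
    rw [Measure.infinitePi_map_pi (f := fun n σ => τ n * σ) _ fun n => measurable_from_top]
    simp only [(measurePreserving_mul_uniform _).map_eq]
  have h2 {ι X : Type} [MeasurableSpace X] (e : ι ≃ ι) (μ : Measure X) [IsProbabilityMeasure μ] :
      MeasurePreserving (fun (f : ι → X) i => f (e i))
        (Measure.infinitePi fun _ => μ) (Measure.infinitePi fun _ => μ) :=
    ⟨by fun_prop, Measure.map_infinitePi_infinitePi_of_inj e.injective⟩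
  unfold rowLaw markLaw choiceLaw countLaw videoLaw positionLaw
  exact (MeasurePreserving.prod (.id _) (MeasurePreserving.prod (.id _) (MeasurePreserving.prod
    (.id _) (MeasurePreserving.prod (MeasurePreserving.prod (.id _) h1) (h2 π.symm _))))).prod
      (h2 (relabel π).symm _)

/-- If `τ` and `π` agree at the size of the scheduling permutation in use, `permuteSlots τ π` moves
the transmitter of slot `t` to slot `π t`. -/
theorem activeIn_permuteSlots (τ : ∀ n, Equiv.Perm (Fin n)) (π : Equiv.Perm ℕ) (y : Row L M)
    (h : π = (τ (max y.1.Nm (p.slots y.1.Nm))).extendDomain Fin.equivSubtype) (t : ℕ) :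
    p.activeIn (permuteSlots τ π y).1 (π t) = relabel π (p.activeIn y.1 t) := by
  classical
  by_cases ht : t < max y.1.Nm (p.slots y.1.Nm)
  · have h1 : π t = τ (max y.1.Nm (p.slots y.1.Nm)) ⟨t, ht⟩ := by
      have := Equiv.Perm.extendDomain_apply_image (τ (max y.1.Nm (p.slots y.1.Nm)))
        Fin.equivSubtype ⟨t, ht⟩
      rw [← h] at this
      exact this
    have h2 : π t < max y.1.Nm (p.slots y.1.Nm) := h1 ▸ Fin.isLt _
    have h3 : (p.schedule (permuteSlots τ π y).1).symm ⟨π t, h2⟩ =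
        (p.schedule y.1).symm ⟨t, ht⟩ := by
      refine (Equiv.symm_apply_eq (p.schedule (permuteSlots τ π y).1)).2 ?_
      change (⟨π t, h2⟩ : Fin (max y.1.Nm (p.slots y.1.Nm))) =
        τ _ ((p.schedule y.1) ((p.schedule y.1).symm ⟨t, ht⟩))
      rw [Equiv.apply_symm_apply]
      exact Fin.ext h1
    unfold activeIn
    rw [dif_pos ht]
    refine (dif_pos h2).trans ?_
    simp only [h3]
    change (if _ < y.1.Nm then Sum.inl (y.1.source (Nat.nth y.1.Matched _)) else Sum.inr (π t)) = _
    split_ifs <;> rfl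
  · have h1 : π t = t := by
      rw [h]
      exact Equiv.Perm.extendDomain_apply_not_subtype _ _ ht
    unfold activeIn
    rw [dif_neg ht]
    exact dif_neg (show ¬ π t < max y.1.Nm (p.slots y.1.Nm) by rwa [h1])

theorem sourcePos_permuteSlots (τ : ∀ n, Equiv.Perm (Fin n)) (π : Equiv.Perm ℕ) (y : Row L M)
    (c : Source) : sourcePos (permuteSlots τ π y).1 (relabel π c) = sourcePos y.1 c := by
  cases c with
  | inl j => rfl
  | inr t => exact congrArg y.1.2.2.2.2 (π.symm_apply_apply t)

theorem fading_permuteSlots (τ : ∀ n, Equiv.Perm (Fin n)) (π : Equiv.Perm ℕ) (y : Row L M)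
    (c : Source) : (permuteSlots τ π y).2 (relabel π c) = y.2 c :=
  congrArg y.2 ((relabel π).symm_apply_apply c)

theorem rowContribution_permuteSlots (τ : ∀ n, Equiv.Perm (Fin n)) (π : Equiv.Perm ℕ)
    (y : Row L M) (h : π = (τ (max y.1.Nm (p.slots y.1.Nm))).extendDomain Fin.equivSubtype)
    (x d : Plane) (n s s' : ℕ) (hA : (activeSlots n (p.slots y.1.Nm) s').image π =
      activeSlots n (p.slots y.1.Nm) s) :
    p.rowContribution (permuteSlots τ π y) x d n s = p.rowContribution y x d n s' := by
  have hN : (permuteSlots τ π y).1.Nm = y.1.Nm := rfl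
  unfold rowContribution
  rw [hN, ← hA, Finset.sum_image (fun _ _ _ _ hab => π.injective hab)]
  congr 1
  refine Finset.sum_congr rfl fun t _ => ?_
  rw [p.activeIn_permuteSlots τ π y h, sourcePos_permuteSlots, fading_permuteSlots]

/-- The contribution of one cluster has the same law in every slot. The number of matches, on which
the exchange of slots depends, is not affected by the exchange, so that the events `Nm = N` can be
treated one by one. -/
theorem lintegral_rowContribution_slot (x d : Plane) {n s s' : ℕ} (hs : s < n) (hs' : s' < n)
    {φ : ℝ≥0 → ℝ≥0∞} (hφ : Measurable φ) :
    ∫⁻ y, φ (p.rowContribution y x d n s) ∂p.rowLaw =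
      ∫⁻ y, φ (p.rowContribution y x d n s') ∂p.rowLaw := by
  have hC (s : ℕ) : Measurable fun y : Row L M => p.rowContribution y x d n s :=
    p.measurable_rowContribution_comp measurable_id measurable_const measurable_const n s
  have hφC (s : ℕ) : Measurable fun y : Row L M => φ (p.rowContribution y x d n s) :=
    hφ.comp (hC s)
  have hN (N : ℕ) : MeasurableSet {y : Row L M | y.1.Nm = N} :=
    (Mark.measurable_Nm.comp measurable_fst) (measurableSet_singleton N)
  have split (s : ℕ) : ∫⁻ y, φ (p.rowContribution y x d n s) ∂p.rowLaw =
      ∑' N, ∫⁻ y, {y : Row L M | y.1.Nm = N}.indicator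
        (fun y => φ (p.rowContribution y x d n s)) y ∂p.rowLaw := by
    rw [← lintegral_tsum fun N => ((hφC s).indicator (hN N)).aemeasurable]
    refine lintegral_congr fun y => ?_
    rw [tsum_eq_single y.1.Nm fun N hne => Set.indicator_of_notMem (fun h => hne h.symm) _]
    rw [Set.indicator_of_mem (show y ∈ {z : Row L M | z.1.Nm = y.1.Nm} from rfl)]
  rw [split s, split s']
  refine tsum_congr fun N => ?_
  obtain ⟨τ₀, hτ₀⟩ := exists_perm_image_eq (Z := max N (p.slots N))
    (A := activeSlots n (p.slots N) s) (B := activeSlots n (p.slots N) s')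
    (fun t ht => lt_max_of_lt_right (activeSlots_lt (p.one_le_slots N) hs ht))
    (fun t ht => lt_max_of_lt_right (activeSlots_lt (p.one_le_slots N) hs' ht))
    (card_activeSlots _ _ _ _)
  -- on `Nm = N` only the scheduling permutation of size `max N (slots N)` is in use
  let τ : ∀ n, Equiv.Perm (Fin n) := Function.update (fun _ => 1) (max N (p.slots N)) τ₀
  have hτ : τ (max N (p.slots N)) = τ₀ := Function.update_self ..
  rw [← (p.measurePreserving_permuteSlots τ (τ₀.extendDomain Fin.equivSubtype)).lintegral_comp
    ((hφC s).indicator (hN N))]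
  refine lintegral_congr fun y => ?_
  by_cases hy : y.1.Nm = N
  · rw [Set.indicator_of_mem (show permuteSlots τ _ y ∈ {y : Row L M | y.1.Nm = N} from hy),
      Set.indicator_of_mem (show y ∈ {y : Row L M | y.1.Nm = N} from hy),
      p.rowContribution_permuteSlots τ _ y (by rw [hy, hτ]) x d n s s' (by rw [hy, hτ₀])]
  · rw [Set.indicator_of_notMem (show permuteSlots τ _ y ∉ {y : Row L M | y.1.Nm = N} from hy),
      Set.indicator_of_notMem (show y ∉ {y : Row L M | y.1.Nm = N} from hy)]

end D2DParams

/-! ### The interference as a functional of independent rows -/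

namespace D2DParams

variable {L M : ℕ} (p : D2DParams L M)

open scoped Classical in
/-- The interference at the point with position `d` relative to the point with label `k`, as a
function of the ground process and of the rows of all the clusters. -/
noncomputable def rowInterference (g : Ground) (k : ℕ) (d : Plane) (n s : ℕ) (y : ℕ → Row L M) :
    ℝ≥0∞ :=
  ∑' k', if (g k').1 = true ∧ k' ≠ k then
    ENNReal.ofReal p.P * (p.rowContribution (y k') (g k').2 ((g k).2 + d) n s : ℝ≥0∞) else 0

theorem interference_eq (ω : Network L M) (k i : ℕ) (d : Plane) (n s : ℕ) :
    p.interference ω k i d n s = p.rowInterference ω.1 k d n s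
      fun k' => (ω.mark k', fun c => ω.fading k' c k i) := by
  unfold interference rowInterference
  simp only [contribution_eq]
  refine tsum_congr fun k' => ?_
  by_cases h : ω.Present k' ∧ k' ≠ k
  · exact (if_pos h).trans (if_pos h).symm
  · exact (if_neg h).trans (if_neg h).symm

theorem rowContribution_add (y : Row L M) (x d t : Plane) (n s : ℕ) :
    p.rowContribution y (x + t) (d + t) n s = p.rowContribution y x d n s := by
  unfold rowContribution
  congr 1
  refine Finset.sum_congr rfl fun u _ => ?_
  rw [add_right_comm, nndist_add_right]

/-- Only relative positions matter for the interference. -/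
theorem rowInterference_shift (g : Ground) (t : Plane) (k : ℕ) (d : Plane) (n s : ℕ)
    (y : ℕ → Row L M) :
    p.rowInterference (g.shift t) k d n s y = p.rowInterference g k d n s y := by
  unfold rowInterference
  refine tsum_congr fun k' => ?_
  have : p.rowContribution (y k') (g.shift t k').2 ((g.shift t k).2 + d) n s =
      p.rowContribution (y k') (g k').2 ((g k).2 + d) n s := by
    rw [← p.rowContribution_add (y k') (g k').2 _ t]
    congr 1
    exact add_right_comm _ _ _
  rw [this]
  rfl

theorem interference_shift (ω : Network L M) (t : Plane) (k i : ℕ) (d : Plane) (n s : ℕ) :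
    p.interference (ω.shift t) k i d n s = p.interference ω k i d n s := by
  rw [interference_eq, interference_eq]
  exact p.rowInterference_shift ω.1 t k d n s _

theorem measurableSet_present (k : ℕ) : MeasurableSet {g : Ground | (g k).1 = true} :=
  (measurable_fst.comp (measurable_pi_apply k)) (measurableSet_singleton true)

theorem measurable_rowInterference_comp {α : Type*} [MeasurableSpace α] {g : α → Ground}
    {d : α → Plane} {y : α → ℕ → Row L M} (hg : Measurable g) (hd : Measurable d)
    (hy : Measurable y) (k n s : ℕ) :
    Measurable fun a => p.rowInterference (g a) k (d a) n s (y a) := by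
  unfold rowInterference
  refine Measurable.tsum fun k' => ?_
  have hx (j : ℕ) : Measurable fun a => (g a j).2 :=
    measurable_snd.comp ((measurable_pi_apply j).comp hg)
  refine Measurable.ite ?_ ?_ measurable_const
  · by_cases h : k' = k
    · simp [h]
    · simpa [h] using hg (measurableSet_present k')
  · exact ((p.measurable_rowContribution_comp ((measurable_pi_apply k').comp hy) (hx k')
      ((hx k).add hd) n s).coe_nnreal_ennreal).const_mul _

theorem measurable_interference_comp {α : Type*} [MeasurableSpace α] {ω : α → Network L M}
    {d : α → Plane} (hω : Measurable ω) (hd : Measurable d) (k i n s : ℕ) :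
    Measurable fun a => p.interference (ω a) k i (d a) n s := by
  simp only [interference_eq]
  have h1 : Measurable fun ω : Network L M =>
      fun k' => (ω.mark k', fun c => ω.fading k' c k i) := by
    unfold Network.mark Network.fading
    fun_prop
  exact p.measurable_rowInterference_comp (measurable_fst.comp hω) hd (h1.comp hω) k n s

/-- The marks of all the clusters and the fading coefficients. -/
abbrev Randomness (L M : ℕ) : Type := (ℕ → Mark L M) × ((ℕ × Source) × (ℕ × ℕ) → ℝ≥0)

/-- The law of the marks and of the fading coefficients. -/
noncomputable def randomnessLaw : Measure (Randomness L M) :=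
  (Measure.infinitePi fun _ : ℕ => p.markLaw).prod
    (Measure.infinitePi fun _ : (ℕ × Source) × (ℕ × ℕ) => p.fadingLaw)

instance isProbabilityMeasure_randomnessLaw : IsProbabilityMeasure p.randomnessLaw := by
  unfold randomnessLaw; infer_instance

/-- The law of the rows of all the clusters, seen from one listener. -/
noncomputable def rowsLaw : Measure (ℕ → Row L M) := Measure.infinitePi fun _ : ℕ => p.rowLaw

instance isProbabilityMeasure_rowsLaw : IsProbabilityMeasure p.rowsLaw := by
  unfold rowsLaw; infer_instance

/-- The rows that user `i` of cluster `k` is exposed to. -/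
def rows (k i : ℕ) (z : Randomness L M) : ℕ → Row L M :=
  fun k' => (z.1 k', fun c => z.2 ((k', c), (k, i)))

/-- The rows seen from one listener are i.i.d. -/
theorem measurePreserving_rows (k i : ℕ) :
    MeasurePreserving (rows k i) p.randomnessLaw p.rowsLaw := by
  have h1 : MeasurePreserving
      (fun (f : (ℕ × Source) × (ℕ × ℕ) → ℝ≥0) (c : ℕ × Source) => f (c, (k, i)))
      (Measure.infinitePi fun _ => p.fadingLaw) (Measure.infinitePi fun _ => p.fadingLaw) :=
    ⟨by fun_prop, Measure.map_infinitePi_infinitePi_of_inj (P := fun _ => p.fadingLaw)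
      (f := fun c : ℕ × Source => (c, (k, i))) fun a b h => (Prod.mk.inj h).1⟩
  have h2 : MeasurePreserving (MeasurableEquiv.curry ℕ Source ℝ≥0)
      (Measure.infinitePi fun _ => p.fadingLaw)
      (Measure.infinitePi fun _ => Measure.infinitePi fun _ => p.fadingLaw) :=
    ⟨MeasurableEquiv.measurable _, Measure.infinitePi_map_curry fun _ _ => p.fadingLaw⟩
  have h3 : MeasurePreserving
      (fun (z : (ℕ → Mark L M) × (ℕ → Source → ℝ≥0)) k' => (z.1 k', z.2 k'))
      ((Measure.infinitePi fun _ => p.markLaw).prod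
        (Measure.infinitePi fun _ => Measure.infinitePi fun _ => p.fadingLaw)) p.rowsLaw :=
    ⟨by fun_prop, infinitePi_prod_map_pair _ _⟩
  exact h3.comp ((MeasurePreserving.id _).prod (h2.comp h1))

theorem interference_randomness (g : Ground) (z : Randomness L M) (k i : ℕ) (d : Plane)
    (n s : ℕ) : p.interference (g, z) k i d n s = p.rowInterference g k d n s (rows k i z) :=
  p.interference_eq _ _ _ _ _ _

/-- All the slots of a cluster see the same interference in law. -/
theorem lintegral_rowInterference_slot (g : Ground) (k : ℕ) (d : Plane) {n s s' : ℕ} (hs : s < n)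
    (hs' : s' < n) {φ : ℝ≥0∞ → ℝ≥0∞} (hφ : Measurable φ) :
    ∫⁻ y, φ (p.rowInterference g k d n s y) ∂p.rowsLaw =
      ∫⁻ y, φ (p.rowInterference g k d n s' y) ∂p.rowsLaw := by
  classical
  let Ψ : (ℕ → ℝ≥0) → ℝ≥0∞ := fun v => ∑' k', if (g k').1 = true ∧ k' ≠ k then
    ENNReal.ofReal p.P * (v k' : ℝ≥0∞) else 0
  have hΨ : Measurable Ψ := by
    refine Measurable.tsum fun k' => ?_
    split_ifs <;> fun_prop
  have hmeas (s k' : ℕ) : Measurable fun y : Row L M =>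
      p.rowContribution y (g k').2 ((g k).2 + d) n s :=
    p.measurable_rowContribution_comp measurable_id measurable_const measurable_const n s
  have hmap (s : ℕ) : ∫⁻ y, φ (p.rowInterference g k d n s y) ∂p.rowsLaw =
      ∫⁻ v, φ (Ψ v) ∂Measure.infinitePi fun k' =>
        p.rowLaw.map fun y => p.rowContribution y (g k').2 ((g k).2 + d) n s := by
    have mp : MeasurePreserving
        (fun (y : ℕ → Row L M) k' => p.rowContribution (y k') (g k').2 ((g k).2 + d) n s)
        p.rowsLaw (Measure.infinitePi fun k' =>
          p.rowLaw.map fun y => p.rowContribution y (g k').2 ((g k).2 + d) n s) :=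
      ⟨measurable_pi_lambda _ fun k' => (hmeas s k').comp (measurable_pi_apply k'),
        Measure.infinitePi_map_pi _ (hmeas s)⟩
    exact mp.lintegral_comp (f := fun v => φ (Ψ v)) (hφ.comp hΨ)
  rw [hmap, hmap]
  congr 2
  funext k'
  refine Measure.ext_of_lintegral _ fun f hf => ?_
  rw [lintegral_map hf (hmeas s k'), lintegral_map hf (hmeas s' k')]
  exact p.lintegral_rowContribution_slot _ _ hs hs' hf

/-- The law of the interference does not depend on how the points of the ground process are
labelled. -/
theorem lintegral_rowInterference_relabel {g g' : Ground}
    (e : {j // (g' j).1 = true} ≃ {j // (g j).1 = true}) (he : ∀ j, (g (e j)).2 = (g' j).2)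
    (j : {j // (g' j).1 = true}) (d : Plane) (n s : ℕ) {φ : ℝ≥0∞ → ℝ≥0∞} (hφ : Measurable φ) :
    ∫⁻ y, φ (p.rowInterference g (e j) d n s y) ∂p.rowsLaw =
      ∫⁻ y, φ (p.rowInterference g' j d n s y) ∂p.rowsLaw := by
  classical
  let Ψ : ({j // (g' j).1 = true} → Row L M) → ℝ≥0∞ := fun z => ∑' i, if i ≠ j then
    ENNReal.ofReal p.P * (p.rowContribution (z i) (g' i).2 ((g' j).2 + d) n s : ℝ≥0∞) else 0
  have hΨ : Measurable Ψ := by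
    refine Measurable.tsum fun i => ?_
    split_ifs
    · exact ((p.measurable_rowContribution_comp (measurable_pi_apply i) measurable_const
        measurable_const n s).coe_nnreal_ennreal).const_mul _
    · exact measurable_const
  have h1 (y : ℕ → Row L M) : p.rowInterference g' j d n s y = Ψ fun i => y i := by
    unfold rowInterference
    change _ = ∑' i : {j | (g' j).1 = true}, if i ≠ j then _ else 0
    trans ∑' i : {j | (g' j).1 = true}, if (i : ℕ) ≠ (j : ℕ) then ENNReal.ofReal p.P *
      (p.rowContribution (y i) (g' i).2 ((g' j).2 + d) n s : ℝ≥0∞) else 0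
    · rw [tsum_subtype {j | (g' j).1 = true} fun i : ℕ => if i ≠ (j : ℕ) then ENNReal.ofReal p.P *
        (p.rowContribution (y i) (g' i).2 ((g' j).2 + d) n s : ℝ≥0∞) else 0]
      refine tsum_congr fun i => ?_
      by_cases hi : (g' i).1 = true <;> simp [Set.indicator, hi]
    · simp only [ne_eq, Subtype.ext_iff]
  have h2 (y : ℕ → Row L M) : p.rowInterference g (e j) d n s y = Ψ fun i => y (e i) := by
    unfold rowInterference
    trans ∑' i : {j | (g j).1 = true}, if (i : ℕ) ≠ (e j : ℕ) then ENNReal.ofReal p.P *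
      (p.rowContribution (y i) (g i).2 ((g (e j)).2 + d) n s : ℝ≥0∞) else 0
    · rw [tsum_subtype {j | (g j).1 = true} fun i : ℕ => if i ≠ (e j : ℕ) then
        ENNReal.ofReal p.P *
        (p.rowContribution (y i) (g i).2 ((g (e j)).2 + d) n s : ℝ≥0∞) else 0]
      refine tsum_congr fun i => ?_
      by_cases hi : (g i).1 = true <;> simp [Set.indicator, hi]
    · refine (e.tsum_eq _).symm.trans ?_
      refine tsum_congr fun i => ?_
      simp only [he, ne_eq, ← Subtype.ext_iff, e.injective.eq_iff]
  simp only [h1, h2]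
  have h3 (f : {j // (g' j).1 = true} → ℕ) (hf : Function.Injective f) :
      ∫⁻ y, φ (Ψ fun i => y (f i)) ∂p.rowsLaw =
        ∫⁻ z, φ (Ψ z) ∂Measure.infinitePi fun _ => p.rowLaw := by
    have mp : MeasurePreserving (fun (y : ℕ → Row L M) i => y (f i)) p.rowsLaw
        (Measure.infinitePi fun _ => p.rowLaw) :=
      ⟨by fun_prop, Measure.map_infinitePi_infinitePi_of_inj (P := fun _ : ℕ => p.rowLaw) hf⟩
    exact mp.lintegral_comp (f := fun z => φ (Ψ z)) (hφ.comp hΨ)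
  rw [h3 (fun i => e i) (Subtype.val_injective.comp e.injective), h3 _ Subtype.val_injective]

/-! ### Rate and threshold -/

/-- The gain that is needed for the rate `R` with `n` slots under the interference `I`. -/
noncomputable def threshold (n : ℕ) (I : ℝ≥0∞) : ℝ≥0∞ :=
  I * ENNReal.ofReal ((2 : ℝ) ^ ((n : ℝ) * p.R) - 1) / ENNReal.ofReal p.P

theorem measurable_threshold (n : ℕ) : Measurable (p.threshold n) := by
  unfold threshold; fun_prop

/-- Without interference the rate is infinite if the gain is positive, and zero (as `0 / 0 = 0`) if
the gain vanishes; both agree with the threshold `0`. With infinite interference the rate is zero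
and the threshold infinite. -/
theorem lt_rate_iff {n : ℕ} (hn : 1 ≤ n) (g : ℝ≥0) (I : ℝ≥0∞) :
    (p.R : EReal) < p.rate n g I ↔ p.threshold n I < g := by
  have hn' : (0 : ℝ) < n := by exact_mod_cast hn
  have hlog : (0 : ℝ) < Real.log 2 := Real.log_pos one_lt_two
  have hc : (0 : ℝ) < n * Real.log 2 := by positivity
  have hpow : (1 : ℝ) < (2 : ℝ) ^ ((n : ℝ) * p.R) :=
    Real.one_lt_rpow one_lt_two (mul_pos hn' p.R_pos)
  have hP : ENNReal.ofReal p.P ≠ 0 := by simpa using p.P_pos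
  unfold rate threshold
  rw [EReal.lt_div_iff (by exact_mod_cast hc) (EReal.coe_ne_top _), ← EReal.coe_mul]
  have h1 : p.R * (n * Real.log 2) = Real.log ((2 : ℝ) ^ ((n : ℝ) * p.R)) := by
    rw [Real.log_rpow two_pos]; ring
  rw [h1, ← ENNReal.log_ofReal_of_pos (by linarith), ENNReal.log_lt_log_iff,
    ← ENNReal.sub_lt_iff_lt_left ENNReal.one_ne_top (by simpa using hpow.le),
    ← ENNReal.ofReal_one, ← ENNReal.ofReal_sub _ zero_le_one,
    ENNReal.lt_div_iff_mul_lt (Or.inr ENNReal.ofReal_ne_top)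
      (Or.inr (by simpa using hpow)),
    ENNReal.div_lt_iff (Or.inl hP) (Or.inl ENNReal.ofReal_ne_top), mul_comm I,
    mul_comm (g : ℝ≥0∞)]

theorem measurable_gainCcdf_comp {α : Type*} [MeasurableSpace α] {S D : α → Plane} {t : α → ℝ≥0∞}
    (hS : Measurable S) (hD : Measurable D) (ht : Measurable t) :
    Measurable fun a => p.gainCcdf (S a) (D a) (t a) := by
  have hset : MeasurableSet {q : (ℝ≥0∞ × ℝ≥0) × ℝ≥0 | q.1.1 < (q.2 : ℝ≥0∞)} :=
    measurableSet_lt (by fun_prop) (by fun_prop)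
  have h := Kernel.measurable_kernel_prodMk_left (κ := p.gainLaw.comap Prod.snd measurable_snd)
    hset
  exact h.comp (ht.prodMk (hS.nndist hD))

theorem gainCcdf_le_one (S D : Plane) (t : ℝ≥0∞) : p.gainCcdf S D t ≤ 1 := prob_le_one

end D2DParams

/-! ### The number of scheduled requests -/

namespace D2DParams

variable {L M : ℕ} (p : D2DParams L M)

theorem slots_eq_or (N : ℕ) : p.slots N = slotsLow N ∨ p.slots N = slotsHigh N := by
  unfold slots; split_ifs <;> simp

theorem le_slotsHigh (N : ℕ) : N ≤ slotsHigh N := Nat.le_pow_clog one_lt_two N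

theorem slotsLow_le {N : ℕ} (hN : N ≠ 0) : slotsLow N ≤ N := Nat.pow_log_le_self 2 hN

open scoped Classical in
/-- The number of scheduled requests is a function of the number of matches: everything is scheduled
if there are at least as many slots as matches, and otherwise every slot is used. -/
theorem card_scheduled (m : Mark L M) :
    (m.matchedSet.filter fun i => p.Scheduled m i).card = p.numScheduled m.Nm := by
  set W := p.slots m.Nm with hW
  have hrank {i : ℕ} (hi : m.Matched i) : Nat.count m.Matched i < m.Nm :=
    Nat.count_strict_mono hi hi.1
  have hslot {i : ℕ} (hi : m.Matched i) : p.slotOf m i =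
      p.schedule m ⟨Nat.count m.Matched i, lt_max_of_lt_left (hrank hi)⟩ := by
    unfold slotOf
    rw [dif_pos]
  unfold numScheduled
  by_cases hH : p.slots m.Nm = slotsHigh m.Nm
  · have hle : m.Nm ≤ W := by rw [hW, hH]; exact le_slotsHigh _
    rw [if_pos hH, Finset.filter_true_of_mem, ← Mark.Nm_eq_card]
    intro i hi
    rw [Mark.mem_matchedSet] at hi
    refine ⟨hi, ?_⟩
    rw [hslot hi]
    exact (Fin.isLt _).trans_eq (max_eq_right hle)
  · have hWL : W = slotsLow m.Nm := (p.slots_eq_or m.Nm).resolve_right hH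
    have hN : m.Nm ≠ 0 := by
      intro h0
      apply hH
      rw [← hW, hWL, h0]
      simp [slotsLow, slotsHigh]
    have hle : W ≤ m.Nm := hWL ▸ slotsLow_le hN
    rw [if_neg hH, ← hWL, ← Finset.card_range W]
    refine Finset.card_bij (fun i _ => p.slotOf m i) ?_ ?_ ?_
    · intro i hi
      rw [Finset.mem_filter] at hi
      exact Finset.mem_range.2 hi.2.2
    · intro i hi j hj hij
      have hi' := (Finset.mem_filter.1 hi).2.1
      have hj' := (Finset.mem_filter.1 hj).2.1
      rw [hslot hi', hslot hj'] at hij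
      have := (p.schedule m).injective (Fin.ext hij)
      exact Nat.count_injective hi' hj' (Fin.mk.inj this)
    · intro t ht
      rw [Finset.mem_range] at ht
      have htZ : t < max m.Nm (p.slots m.Nm) := lt_max_of_lt_right ht
      set r := (p.schedule m).symm ⟨t, htZ⟩ with hr
      have hrN : (r : ℕ) < m.Nm := r.isLt.trans_eq (max_eq_left hle)
      have hcard (hf : (Set.ofPred m.Matched).Finite) : (r : ℕ) < hf.toFinset.card := by
        have : hf.toFinset = m.matchedSet := by
          ext i
          rw [Set.Finite.mem_toFinset, Mark.mem_matchedSet]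
          rfl
        rwa [this, ← Mark.Nm_eq_card]
      have hmem : m.Matched (Nat.nth m.Matched r) := Nat.nth_mem _ hcard
      have hcount : Nat.count m.Matched (Nat.nth m.Matched r) = r := Nat.count_nth hcard
      have hval : p.slotOf m (Nat.nth m.Matched r) = t := by
        rw [hslot hmem]
        have : (⟨_, lt_max_of_lt_left (hrank hmem)⟩ : Fin (max m.Nm (p.slots m.Nm))) = r :=
          Fin.ext hcount
        rw [this, hr, Equiv.apply_symm_apply]
      exact ⟨_, Finset.mem_filter.2 ⟨(m.mem_matchedSet _).2 hmem, hmem, hval ▸ ht⟩, hval⟩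

open scoped Classical in
theorem sum_scheduled (m : Mark L M) :
    (∑ j ∈ Finset.range m.Nr, if p.Scheduled m j then (1 : ℝ≥0∞) else 0) =
      p.numScheduled m.Nm := by
  rw [← p.card_scheduled m, Finset.sum_boole]
  congr 2
  ext i
  simp only [Finset.mem_filter, Finset.mem_range, Mark.mem_matchedSet]
  exact ⟨fun h => ⟨h.2.1, h.2⟩, fun h => ⟨h.1.1, h.2⟩⟩

theorem one_le_numScheduled {N : ℕ} (hN : 1 ≤ N) : 1 ≤ p.numScheduled N := by
  unfold numScheduled
  split_ifs
  · exact hN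
  · exact Nat.one_le_two_pow

theorem numScheduled_zero : p.numScheduled 0 = 0 := by
  unfold numScheduled
  rw [if_pos]
  rcases p.slots_eq_or 0 with h | h
  · rw [h]; simp [slotsLow, slotsHigh]
  · exact h

/-! ### Replacing a part of the randomness by an independent copy -/

/-- A measure preserving action of an independent variable on a factor extends to the product with
another factor. -/
theorem measurePreserving_pass {α β γ : Type*} [MeasurableSpace α] [MeasurableSpace β]
    [MeasurableSpace γ] {μ : Measure α} {ν : Measure β} {ξ : Measure γ} [SFinite μ] [SFinite ν]
    [SFinite ξ] {T : α × β → β} (hT : MeasurePreserving T (μ.prod ν) ν) :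
    MeasurePreserving (fun q : α × γ × β => (q.2.1, T (q.1, q.2.2))) (μ.prod (ξ.prod ν))
      (ξ.prod ν) := by
  have h1 := (measurePreserving_prodAssoc μ ξ ν).symm
  have h2 : MeasurePreserving (Prod.map Prod.swap id) ((μ.prod ξ).prod ν) ((ξ.prod μ).prod ν) :=
    Measure.measurePreserving_swap.prod (.id ν)
  have h3 := measurePreserving_prodAssoc ξ μ ν
  have h4 : MeasurePreserving (Prod.map id T) (ξ.prod (μ.prod ν)) (ξ.prod ν) :=
    (MeasurePreserving.id ξ).prod hT
  exact h4.comp (h3.comp (h2.comp h1))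

/-- The law of the positions and the gains. -/
noncomputable def positionGainLaw : Measure (Positions × (ℕ × ℕ → ℝ≥0)) :=
  p.positionLaw ⊗ₘ p.gainKernel

instance isProbabilityMeasure_positionLaw : IsProbabilityMeasure p.positionLaw := by
  unfold positionLaw; infer_instance

instance isProbabilityMeasure_positionGainLaw : IsProbabilityMeasure p.positionGainLaw := by
  unfold positionGainLaw; infer_instance

/-- The mark `m` with new positions and gains. -/
def withPositions (b : Positions × (ℕ × ℕ → ℝ≥0)) (m : Mark L M) : Mark L M :=
  (m.1, m.2.1, b, m.2.2.2)

theorem measurePreserving_withPositions :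
    MeasurePreserving (fun q : (Positions × (ℕ × ℕ → ℝ≥0)) × Mark L M => withPositions q.1 q.2)
      (p.positionGainLaw.prod p.markLaw) p.markLaw := by
  have : IsProbabilityMeasure choiceLaw := by unfold choiceLaw; infer_instance
  have : IsProbabilityMeasure p.videoLaw := by unfold videoLaw; infer_instance
  have : IsProbabilityMeasure p.countLaw := by unfold countLaw; infer_instance
  have h := (MeasurePreserving.id p.positionGainLaw).prod
    (measurePreserving_snd (μ := p.positionGainLaw)
      (ν := choiceLaw.prod (Measure.infinitePi fun _ : ℕ => p.unifDisc)))
  exact measurePreserving_pass (ξ := p.countLaw) (measurePreserving_pass (ξ := p.videoLaw) h)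

/-- The joint law of the position of a requesting user and of its gain from a fixed caching user. -/
theorem lintegral_positionGainLaw (j i : ℕ) {f : Plane → ℝ≥0 → ℝ≥0∞}
    (hf : Measurable fun q : Plane × ℝ≥0 => f q.1 q.2) :
    ∫⁻ b, f (b.1.2 i) (b.2 (j, i)) ∂p.positionGainLaw =
      ∫⁻ S, ∫⁻ D, ∫⁻ g, f D g ∂p.gainLaw (nndist S D) ∂p.unifDisc ∂p.unifDisc := by
  have hm : Measurable fun b : Positions × (ℕ × ℕ → ℝ≥0) => f (b.1.2 i) (b.2 (j, i)) :=
    hf.comp (f := fun b : Positions × (ℕ × ℕ → ℝ≥0) => (b.1.2 i, b.2 (j, i))) (by fun_prop)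
  have hk : Measurable fun q : Plane × Plane => ∫⁻ g, f q.2 g ∂p.gainLaw (nndist q.1 q.2) := by
    have h := Measurable.lintegral_kernel_prod_right'
      (κ := p.gainLaw.comap (fun q : Plane × Plane => nndist q.1 q.2) (by fun_prop))
      (f := fun r : (Plane × Plane) × ℝ≥0 => f r.1.2 r.2)
      (hf.comp (f := fun r : (Plane × Plane) × ℝ≥0 => (r.1.2, r.2)) (by fun_prop))
    exact h
  have h1 (q : Positions) : ∫⁻ w, f (q.2 i) (w (j, i)) ∂p.gainKernel q =
      ∫⁻ g, f (q.2 i) g ∂p.gainLaw (nndist (q.1 j) (q.2 i)) :=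
    (measurePreserving_eval_infinitePi
      (fun ji : ℕ × ℕ => p.gainLaw (nndist (q.1 ji.1) (q.2 ji.2))) (j, i)).lintegral_comp
      (f := fun g => f (q.2 i) g) (hf.comp measurable_prodMk_left)
  have h2 : MeasurePreserving (fun q : Positions => (q.1 j, q.2 i)) p.positionLaw
      (p.unifDisc.prod p.unifDisc) :=
    (measurePreserving_eval_infinitePi (fun _ : ℕ => p.unifDisc) j).prod
      (measurePreserving_eval_infinitePi (fun _ : ℕ => p.unifDisc) i)
  unfold positionGainLaw
  rw [Measure.lintegral_compProd hm]
  simp only [h1]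
  rw [h2.lintegral_comp hk, lintegral_prod _ hk.aemeasurable]

/-- The source and the destination of a match may be replaced by fresh uniform points: the videos,
the numbers of users and the random choices, which determine who serves whom, are independent of
positions and gains. -/
theorem lintegral_markLaw_fresh (i : ℕ) {f : Mark L M → Plane → ℝ≥0 → ℝ≥0∞}
    (hf : Measurable fun q : Mark L M × Plane × ℝ≥0 => f q.1 q.2.1 q.2.2)
    (hinv : ∀ b m, f (withPositions b m) = f m) :
    ∫⁻ m, f m (m.D i) (m.gain (m.source i) i) ∂p.markLaw =
      ∫⁻ m, ∫⁻ S, ∫⁻ D, ∫⁻ g, f m D g ∂p.gainLaw (nndist S D) ∂p.unifDisc ∂p.unifDisc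
        ∂p.markLaw := by
  have hgain : Measurable fun m : Mark L M => m.gain (m.source i) i :=
    measurable_of_countable_cases (Mark.measurable_source i) (F := fun j m => m.gain j i)
      fun j => Mark.measurable_gain j i
  have hm : Measurable fun m : Mark L M => f m (m.D i) (m.gain (m.source i) i) :=
    hf.comp (measurable_id.prodMk ((Mark.measurable_D i).prodMk hgain))
  rw [← p.measurePreserving_withPositions.lintegral_comp hm, lintegral_prod_symm]
  · refine lintegral_congr fun m => ?_
    rw [← p.lintegral_positionGainLaw (m.source i) i (hf.comp measurable_prodMk_left)]
    refine lintegral_congr fun b => ?_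
    rw [hinv]
    rfl
  · exact (hm.comp p.measurePreserving_withPositions.measurable).aemeasurable

/-- The randomness with mark `m` for cluster `k`. -/
noncomputable def withMark (k : ℕ) (m : Mark L M) (z : Randomness L M) : Randomness L M :=
  (Function.update z.1 k m, z.2)

theorem measurePreserving_withMark (k : ℕ) :
    MeasurePreserving (fun q : Mark L M × Randomness L M => withMark k q.1 q.2)
      (p.markLaw.prod p.randomnessLaw) p.randomnessLaw := by
  have h1 : MeasurePreserving (fun z : Mark L M × (ℕ → Mark L M) => Function.update z.2 k z.1)
      (p.markLaw.prod (Measure.infinitePi fun _ => p.markLaw))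
      (Measure.infinitePi fun _ => p.markLaw) :=
    ⟨measurable_update_prod k, infinitePi_map_update (fun _ : ℕ => p.markLaw) k⟩
  exact (h1.prod (.id _)).comp (measurePreserving_prodAssoc _ _ _).symm

/-- The interference at a cluster does not involve the mark of the cluster. -/
theorem rowInterference_withMark (g : Ground) (k i : ℕ) (d : Plane) (n s : ℕ) (m : Mark L M)
    (z : Randomness L M) :
    p.rowInterference g k d n s (rows k i (withMark k m z)) =
      p.rowInterference g k d n s (rows k i z) := by
  unfold rowInterference
  refine tsum_congr fun k' => ?_
  by_cases h : k' = k
  · simp [h]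
  · have : rows k i (withMark k m z) k' = rows k i z k' := by
      simp only [rows, withMark, Function.update_of_ne h]
    rw [this]

end D2DParams

/-! ### Mean number of served requests, given the ground process -/

namespace D2DParams

variable {L M : ℕ} (p : D2DParams L M)

-- the σ-algebras on products that contain several marks are nested deeply
set_option synthInstance.maxSize 1000

/-- Service in terms of the threshold and of the rows that the user is exposed to. -/
theorem served_iff (g : Ground) (z : Randomness L M) (k i : ℕ) :
    p.Served (g, z) k i ↔ p.Scheduled (z.1 k) i ∧
      p.threshold (p.slots (z.1 k).Nm) (p.rowInterference g k ((z.1 k).D i)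
        (p.slots (z.1 k).Nm) (p.slotOf (z.1 k) i) (rows k i z)) <
          (z.1 k).gain ((z.1 k).source i) i := by
  unfold Served
  rw [p.lt_rate_iff (p.one_le_slots _), interference_randomness]
  rfl

theorem measurableSet_served (k i : ℕ) : MeasurableSet {ω : Network L M | p.Served ω k i} := by
  have hmark : Measurable fun ω : Network L M => ω.mark k :=
    (measurable_pi_apply k).comp (measurable_fst.comp measurable_snd)
  have hgain : Measurable fun m : Mark L M => m.gain (m.source i) i :=
    measurable_of_countable_cases (Mark.measurable_source i) (F := fun j m => m.gain j i)
      fun j => Mark.measurable_gain j i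
  have hthr : Measurable fun ω : Network L M => p.threshold (p.slots (ω.mark k).Nm)
      (p.interference ω k i ((ω.mark k).D i) (p.slots (ω.mark k).Nm) (p.slotOf (ω.mark k) i)) := by
    refine measurable_of_countable_cases (h := fun ω : Network L M => (ω.mark k).Nm)
      (F := fun N ω => p.threshold (p.slots N)
        (p.interference ω k i ((ω.mark k).D i) (p.slots N) (p.slotOf (ω.mark k) i)))
      (Mark.measurable_Nm.comp hmark) fun N => (p.measurable_threshold _).comp ?_
    exact measurable_of_countable_cases (h := fun ω : Network L M => p.slotOf (ω.mark k) i)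
      (F := fun s ω => p.interference ω k i ((ω.mark k).D i) (p.slots N) s)
      ((p.measurable_slotOf i).comp hmark) fun s =>
        p.measurable_interference_comp measurable_id ((Mark.measurable_D i).comp hmark) k i _ s
  have : {ω : Network L M | p.Served ω k i} =
      {ω | p.Scheduled (ω.mark k) i} ∩ {ω | p.threshold (p.slots (ω.mark k).Nm)
        (p.interference ω k i ((ω.mark k).D i) (p.slots (ω.mark k).Nm) (p.slotOf (ω.mark k) i)) <
          ((ω.mark k).gain ((ω.mark k).source i) i : ℝ≥0∞)} := by
    ext ω
    simp only [Served, Set.mem_ofPred_eq, Set.mem_inter_iff, p.lt_rate_iff (p.one_le_slots _)]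
  rw [this]
  exact (hmark (p.measurableSet_scheduled i)).inter
    (measurableSet_lt hthr (hgain.comp hmark).coe_nnreal_ennreal)

/-- The conditional probability, given the ground process, that a transmission from a uniform source
to a destination at `D` in cluster `k` achieves the rate `R` in slot `s` out of `n`. -/
noncomputable def successAt (g : Ground) (k n s : ℕ) (D : Plane) : ℝ≥0∞ :=
  ∫⁻ S, ∫⁻ y, p.gainCcdf S D (p.threshold n (p.rowInterference g k D n s y)) ∂p.rowsLaw ∂p.unifDisc

theorem measurable_gainCcdf_threshold {α : Type*} [MeasurableSpace α] {g : α → Ground}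
    {S D : α → Plane} {y : α → ℕ → Row L M} (hg : Measurable g) (hS : Measurable S)
    (hD : Measurable D) (hy : Measurable y) (k n s : ℕ) : Measurable fun a =>
      p.gainCcdf (S a) (D a) (p.threshold n (p.rowInterference (g a) k (D a) n s (y a))) :=
  p.measurable_gainCcdf_comp hS hD ((p.measurable_threshold n).comp
    (p.measurable_rowInterference_comp hg hD hy k n s))

theorem measurable_successAt (k n s : ℕ) :
    Measurable fun q : Ground × Plane => p.successAt q.1 k n s q.2 := by
  have h : Measurable fun q : ((Ground × Plane) × Plane) × (ℕ → Row L M) => p.gainCcdf q.1.2 q.1.1.2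
      (p.threshold n (p.rowInterference q.1.1.1 k q.1.1.2 n s q.2)) :=
    p.measurable_gainCcdf_threshold (by fun_prop) (by fun_prop) (by fun_prop) (by fun_prop) k n s
  exact h.lintegral_prod_right'.lintegral_prod_right'

theorem measurable_successAt_right (g : Ground) (k n s : ℕ) : Measurable (p.successAt g k n s) := by
  have h := Measurable.comp (p.measurable_successAt k n s) (measurable_prodMk_left (x := g))
  exact h

theorem measurable_successAt_left (D : Plane) (k n s : ℕ) :
    Measurable fun g => p.successAt g k n s D := by
  have h := Measurable.comp (p.measurable_successAt k n s) (measurable_prodMk_right (y := D))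
  exact h

theorem successAt_le_one (g : Ground) (k n s : ℕ) (D : Plane) : p.successAt g k n s D ≤ 1 := by
  calc p.successAt g k n s D ≤ ∫⁻ _, ∫⁻ _, 1 ∂p.rowsLaw ∂p.unifDisc :=
        lintegral_mono fun S => lintegral_mono fun y => p.gainCcdf_le_one _ _ _
    _ = 1 := by simp

theorem successAt_slot (g : Ground) (k : ℕ) {n s s' : ℕ} (hs : s < n) (hs' : s' < n) (D : Plane) :
    p.successAt g k n s D = p.successAt g k n s' D :=
  lintegral_congr fun _ => p.lintegral_rowInterference_slot g k D hs hs'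
    (φ := fun I => p.gainCcdf _ D (p.threshold n I))
    (p.measurable_gainCcdf_comp measurable_const measurable_const (p.measurable_threshold n))

theorem successAt_shift (g : Ground) (t : Plane) (k n s : ℕ) (D : Plane) :
    p.successAt (g.shift t) k n s D = p.successAt g k n s D := by
  simp only [successAt, rowInterference_shift]

theorem successAt_relabel {g g' : Ground}
    (e : {j // (g' j).1 = true} ≃ {j // (g j).1 = true}) (he : ∀ j, (g (e j)).2 = (g' j).2)
    (j : {j // (g' j).1 = true}) (n s : ℕ) (D : Plane) :
    p.successAt g (e j) n s D = p.successAt g' j n s D :=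
  lintegral_congr fun _ => p.lintegral_rowInterference_relabel e he j D n s
    (φ := fun I => p.gainCcdf _ D (p.threshold n I))
    (p.measurable_gainCcdf_comp measurable_const measurable_const (p.measurable_threshold n))

/-- Averaging the indicator of a sufficient gain over the gain gives its complementary cdf. -/
theorem lintegral_lt_gain (S D : Plane) (c : ℝ≥0∞) (Y : (ℕ → Row L M) → ℝ≥0∞)
    (hY : Measurable Y) :
    ∫⁻ γ, ∫⁻ y, {q : ℝ≥0 × (ℕ → Row L M) | Y q.2 < q.1}.indicator (fun _ => c) (γ, y) ∂p.rowsLaw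
        ∂p.gainLaw (nndist S D) =
      c * ∫⁻ y, p.gainCcdf S D (Y y) ∂p.rowsLaw := by
  have hset : MeasurableSet {q : ℝ≥0 × (ℕ → Row L M) | Y q.2 < q.1} :=
    measurableSet_lt (hY.comp measurable_snd) measurable_fst.coe_nnreal_ennreal
  rw [lintegral_lintegral_swap (f := fun γ y => {q : ℝ≥0 × (ℕ → Row L M) | Y q.2 < q.1}.indicator
    (fun _ => c) (γ, y)) (measurable_const.indicator hset).aemeasurable,
    ← lintegral_const_mul]
  · refine lintegral_congr fun y => ?_
    have h : MeasurableSet {γ : ℝ≥0 | Y y < γ} :=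
      measurableSet_lt measurable_const measurable_id.coe_nnreal_ennreal
    exact lintegral_indicator_const h c
  · exact p.measurable_gainCcdf_comp measurable_const measurable_const hY

open scoped Classical in
/-- The mean number of successes of user `i` of cluster `k`, weighted by a function of the number of
matches and the position of the user. -/
theorem lintegral_served (g : Ground) (k i : ℕ) {u : ℕ → Plane → ℝ≥0∞}
    (hu : ∀ N, Measurable (u N)) {slot : ℕ → ℕ} (hslot : ∀ n, 1 ≤ n → slot n < n) :
    ∫⁻ z, (if p.Served (g, z) k i then u (z.1 k).Nm ((z.1 k).D i) else 0) ∂p.randomnessLaw =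
      ∫⁻ m, (if p.Scheduled m i then 1 else 0) * ∫⁻ D, u m.Nm D *
        p.successAt g k (p.slots m.Nm) (slot (p.slots m.Nm)) D ∂p.unifDisc ∂p.markLaw := by
  have hu' : Measurable fun q : Mark L M × Plane => u q.1.Nm q.2 :=
    measurable_of_countable_cases (Mark.measurable_Nm.comp measurable_fst)
      (F := fun N q => u N q.2) fun N => (hu N).comp measurable_snd
  let Y : Mark L M → Plane → (ℕ → Row L M) → ℝ≥0∞ := fun m D y =>
    p.threshold (p.slots m.Nm) (p.rowInterference g k D (p.slots m.Nm) (p.slotOf m i) y)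
  have hY : Measurable fun q : Mark L M × Plane × (ℕ → Row L M) => Y q.1 q.2.1 q.2.2 := by
    refine measurable_of_countable_cases
      (h := fun q : Mark L M × Plane × (ℕ → Row L M) => q.1.Nm)
      (F := fun N q => p.threshold (p.slots N)
        (p.rowInterference g k q.2.1 (p.slots N) (p.slotOf q.1 i) q.2.2))
      (Mark.measurable_Nm.comp measurable_fst) fun N => (p.measurable_threshold _).comp ?_
    refine measurable_of_countable_cases
      (h := fun q : Mark L M × Plane × (ℕ → Row L M) => p.slotOf q.1 i)
      (F := fun s q => p.rowInterference g k q.2.1 (p.slots N) s q.2.2)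
      ((p.measurable_slotOf i).comp measurable_fst) fun s => ?_
    exact p.measurable_rowInterference_comp measurable_const (by fun_prop) (by fun_prop) k _ s
  -- the indicator of success for a user at `D` with gain `γ`
  let H : Mark L M → Plane → ℝ≥0 → (ℕ → Row L M) → ℝ≥0∞ := fun m D γ y =>
    if p.Scheduled m i then {q : ℝ≥0 × (ℕ → Row L M) | Y m D q.2 < q.1}.indicator
      (fun _ => u m.Nm D) (γ, y) else 0
  have hH : Measurable fun q : (Mark L M × Plane × ℝ≥0) × (ℕ → Row L M) =>
      H q.1.1 q.1.2.1 q.1.2.2 q.2 := by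
    refine Measurable.ite ((p.measurableSet_scheduled i).preimage (by fun_prop)) ?_
      measurable_const
    have hs : MeasurableSet {q : (Mark L M × Plane × ℝ≥0) × (ℕ → Row L M) |
        Y q.1.1 q.1.2.1 q.2 < q.1.2.2} :=
      measurableSet_lt (hY.comp (f := fun q : (Mark L M × Plane × ℝ≥0) × (ℕ → Row L M) =>
        (q.1.1, q.1.2.1, q.2)) (by fun_prop)) (by fun_prop)
    exact (hu'.comp (f := fun q : (Mark L M × Plane × ℝ≥0) × (ℕ → Row L M) =>
      (q.1.1, q.1.2.1)) (by fun_prop)).indicator hs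
  have hmeas : Measurable fun z : Randomness L M =>
      if p.Served (g, z) k i then u (z.1 k).Nm ((z.1 k).D i) else 0 := by
    refine Measurable.ite ((p.measurableSet_served k i).preimage measurable_prodMk_left) ?_
      measurable_const
    have hm : Measurable fun z : Randomness L M => z.1 k := by fun_prop
    exact hu'.comp (hm.prodMk ((Mark.measurable_D i).comp hm))
  have hmeas' : Measurable fun q : Mark L M × Randomness L M =>
      if p.Served (g, withMark k q.1 q.2) k i then
        u ((withMark k q.1 q.2).1 k).Nm (((withMark k q.1 q.2).1 k).D i) else 0 :=
    hmeas.comp (p.measurePreserving_withMark k).measurable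
  rw [← (p.measurePreserving_withMark k).lintegral_comp hmeas,
    lintegral_prod _ hmeas'.aemeasurable]
  have h1 (m : Mark L M) : ∫⁻ z, (if p.Served (g, withMark k m z) k i then
      u ((withMark k m z).1 k).Nm (((withMark k m z).1 k).D i) else 0) ∂p.randomnessLaw =
      ∫⁻ y, H m (m.D i) (m.gain (m.source i) i) y ∂p.rowsLaw := by
    have hH' : Measurable (H m (m.D i) (m.gain (m.source i) i)) :=
      hH.comp (measurable_prodMk_left (x := (m, m.D i, m.gain (m.source i) i)))
    rw [← (p.measurePreserving_rows k i).lintegral_comp hH']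
    refine lintegral_congr fun z => ?_
    have hk : (withMark k m z).1 k = m := Function.update_self ..
    simp only [served_iff, hk, rowInterference_withMark, H, Set.indicator, Set.mem_ofPred_eq]
    by_cases hsch : p.Scheduled m i
    · simp only [hsch, true_and, if_true]; rfl
    · simp only [hsch, false_and, if_false]
  simp only [h1]
  rw [p.lintegral_markLaw_fresh i (f := fun m D γ => ∫⁻ y, H m D γ y ∂p.rowsLaw)
    hH.lintegral_prod_right' fun b m => rfl]
  refine lintegral_congr fun m => ?_
  by_cases hsch : p.Scheduled m i
  -- `successAt_slot` replaces the slot of the request, which depends on the mark, by a fixed slot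
  · have hYm (D : Plane) : Measurable (Y m D) :=
      hY.comp (f := fun y => (m, D, y)) (by fun_prop)
    simp only [H, hsch, if_true, one_mul, p.lintegral_lt_gain _ _ _ _ (hYm _)]
    have hG : Measurable fun q : Plane × Plane =>
        u m.Nm q.2 * ∫⁻ y, p.gainCcdf q.1 q.2 (Y m q.2 y) ∂p.rowsLaw := by
      refine ((hu _).comp measurable_snd).mul ?_
      have : Measurable fun r : (Plane × Plane) × (ℕ → Row L M) =>
          p.gainCcdf r.1.1 r.1.2 (Y m r.1.2 r.2) :=
        p.measurable_gainCcdf_comp (by fun_prop) (by fun_prop)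
          (hY.comp (f := fun r : (Plane × Plane) × (ℕ → Row L M) => (m, r.1.2, r.2)) (by fun_prop))
      exact this.lintegral_prod_right'
    rw [lintegral_lintegral_swap hG.aemeasurable]
    refine lintegral_congr fun D => ?_
    rw [lintegral_const_mul, ← p.successAt_slot g k hsch.2 (hslot _ (p.one_le_slots _))]
    · rfl
    · have : Measurable fun r : Plane × (ℕ → Row L M) => p.gainCcdf r.1 D (Y m D r.2) :=
        p.measurable_gainCcdf_comp (by fun_prop) (by fun_prop) ((hYm D).comp measurable_snd)
      exact this.lintegral_prod_right'
  · simp [H, hsch]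

open scoped Classical in
/-- Given the ground process, the served requests of cluster `k`, weighted by a function of the number
of matches and of the position of the user. -/
theorem lintegral_sum_served (g : Ground) (k : ℕ) {u : ℕ → Plane → ℝ≥0∞}
    (hu : ∀ N, Measurable (u N)) {slot : ℕ → ℕ} (hslot : ∀ n, 1 ≤ n → slot n < n) :
    ∫⁻ z, ∑ i ∈ Finset.range (z.1 k).Nr,
        (if p.Served (g, z) k i then u (z.1 k).Nm ((z.1 k).D i) else 0) ∂p.randomnessLaw =
      ∫⁻ m, (p.numScheduled m.Nm : ℝ≥0∞) * ∫⁻ D, u m.Nm D *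
        p.successAt g k (p.slots m.Nm) (slot (p.slots m.Nm)) D ∂p.unifDisc ∂p.markLaw := by
  have hu' : Measurable fun q : Mark L M × Plane => u q.1.Nm q.2 :=
    measurable_of_countable_cases (Mark.measurable_Nm.comp measurable_fst)
      (F := fun N q => u N q.2) fun N => (hu N).comp measurable_snd
  have h1 (z : Randomness L M) : ∑ i ∈ Finset.range (z.1 k).Nr,
      (if p.Served (g, z) k i then u (z.1 k).Nm ((z.1 k).D i) else 0) =
      ∑' i, if p.Served (g, z) k i then u (z.1 k).Nm ((z.1 k).D i) else 0 := by
    refine (tsum_eq_sum fun i hi => if_neg fun h => hi ?_).symm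
    exact Finset.mem_range.2 h.1.1.1
  have h2 (m : Mark L M) : (p.numScheduled m.Nm : ℝ≥0∞) =
      ∑' i, if p.Scheduled m i then 1 else 0 := by
    rw [← sum_scheduled]
    refine (tsum_eq_sum fun i hi => if_neg fun h => hi ?_).symm
    exact Finset.mem_range.2 h.1.1
  simp only [h1, h2, ← ENNReal.tsum_mul_right]
  rw [lintegral_tsum, lintegral_tsum]
  · exact tsum_congr fun i => p.lintegral_served g k i hu hslot
  · intro i
    refine Measurable.aemeasurable (Measurable.mul (Measurable.ite (p.measurableSet_scheduled i)
      measurable_const measurable_const) ?_)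
    exact measurable_of_countable_cases Mark.measurable_Nm (F := fun N _ => ∫⁻ D, u N D *
      p.successAt g k (p.slots N) (slot (p.slots N)) D ∂p.unifDisc) fun N => measurable_const
  · intro i
    refine Measurable.aemeasurable (Measurable.ite
      ((p.measurableSet_served k i).preimage measurable_prodMk_left) ?_ measurable_const)
    have hm : Measurable fun z : Randomness L M => z.1 k := by fun_prop
    exact hu'.comp (hm.prodMk ((Mark.measurable_D i).comp hm))

/-- The mean of `success`, weighted by a function of the number of matches. -/
theorem lintegral_mul_success (g : Ground) (k : ℕ) (a : ℕ → ℝ≥0∞) (slot : ℕ → ℕ) :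
    ∫⁻ z, a (z.1 k).Nm * p.success (g, z) k (p.slots (z.1 k).Nm) (slot (p.slots (z.1 k).Nm))
        ∂p.randomnessLaw =
      ∫⁻ m, a m.Nm * ∫⁻ D,
        p.successAt g k (p.slots m.Nm) (slot (p.slots m.Nm)) D ∂p.unifDisc ∂p.markLaw := by
  have hs (z : Randomness L M) (n s : ℕ) : p.success (g, z) k n s = ∫⁻ S, ∫⁻ D, p.gainCcdf S D
      (p.threshold n (p.rowInterference g k D n s (rows k 0 z))) ∂p.unifDisc ∂p.unifDisc := by
    simp only [success, interference_randomness]; rfl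
  let Φ : ℕ → (ℕ → Row L M) → ℝ≥0∞ := fun n y => ∫⁻ S, ∫⁻ D, p.gainCcdf S D
      (p.threshold n (p.rowInterference g k D n (slot n) y)) ∂p.unifDisc ∂p.unifDisc
  have hj (n : ℕ) : Measurable fun q : ((ℕ → Row L M) × Plane) × Plane => p.gainCcdf q.1.2 q.2
      (p.threshold n (p.rowInterference g k q.2 n (slot n) q.1.1)) :=
    p.measurable_gainCcdf_threshold (by fun_prop) (by fun_prop) (by fun_prop) (by fun_prop) k n _
  have hΦ (n : ℕ) : Measurable (Φ n) := (hj n).lintegral_prod_right'.lintegral_prod_right'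
  have hmeas : Measurable fun z : Randomness L M =>
      a (z.1 k).Nm * Φ (p.slots (z.1 k).Nm) (rows k 0 z) :=
    measurable_of_countable_cases (h := fun z : Randomness L M => (z.1 k).Nm)
      (F := fun N z => a N * Φ (p.slots N) (rows k 0 z))
      (Mark.measurable_Nm.comp (by fun_prop)) fun N =>
        ((hΦ _).comp (p.measurePreserving_rows k 0).measurable).const_mul _
  simp only [hs]
  change ∫⁻ z, a (z.1 k).Nm * Φ (p.slots (z.1 k).Nm) (rows k 0 z) ∂p.randomnessLaw = _
  have hmeas' : Measurable fun q : Mark L M × Randomness L M =>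
      a ((withMark k q.1 q.2).1 k).Nm * Φ (p.slots ((withMark k q.1 q.2).1 k).Nm)
        (rows k 0 (withMark k q.1 q.2)) :=
    hmeas.comp (p.measurePreserving_withMark k).measurable
  rw [← (p.measurePreserving_withMark k).lintegral_comp hmeas,
    lintegral_prod _ hmeas'.aemeasurable]
  refine lintegral_congr fun m => ?_
  have hk (z : Randomness L M) : (withMark k m z).1 k = m := Function.update_self ..
  simp only [hk, Φ, rowInterference_withMark]
  change ∫⁻ z, a m.Nm * Φ (p.slots m.Nm) (rows k 0 z) ∂p.randomnessLaw = _
  rw [(p.measurePreserving_rows k 0).lintegral_comp (f := fun y => a m.Nm * Φ (p.slots m.Nm) y)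
    ((hΦ _).const_mul _), lintegral_const_mul _ (hΦ _)]
  congr 1
  simp only [Φ, successAt]
  -- the order of integration `y, S, D` becomes `D, S, y`
  rw [lintegral_lintegral_swap (f := fun y S => ∫⁻ D, p.gainCcdf S D (p.threshold (p.slots m.Nm)
      (p.rowInterference g k D (p.slots m.Nm) (slot (p.slots m.Nm)) y)) ∂p.unifDisc)
      (hj _).lintegral_prod_right'.aemeasurable]
  rw [lintegral_lintegral_swap (f := fun D S => ∫⁻ y, p.gainCcdf S D (p.threshold (p.slots m.Nm)
      (p.rowInterference g k D (p.slots m.Nm) (slot (p.slots m.Nm)) y)) ∂p.rowsLaw)]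
  · refine lintegral_congr fun S => lintegral_lintegral_swap ?_
    exact (p.measurable_gainCcdf_threshold measurable_const measurable_const measurable_snd
      measurable_fst k _ _).aemeasurable
  · have : Measurable fun q : (Plane × Plane) × (ℕ → Row L M) => p.gainCcdf q.1.2 q.1.1
        (p.threshold (p.slots m.Nm)
        (p.rowInterference g k q.1.1 (p.slots m.Nm) (slot (p.slots m.Nm)) q.2)) :=
      p.measurable_gainCcdf_threshold (by fun_prop) (by fun_prop) (by fun_prop) (by fun_prop) k _ _
    exact this.lintegral_prod_right'.aemeasurable

end D2DParams

/-! ### Hard-core configurations and their canonical labelling -/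

namespace Ground

/-- Distinct points of the configuration have distance at least `δ`. -/
def HardCore (δ : ℝ) (g : Ground) : Prop :=
  ∀ j k, j ≠ k → (g j).1 = true → (g k).1 = true → δ ≤ dist (g j).2 (g k).2

/-- A countable partition of the plane into measurable sets of diameter less than `δ`. -/
noncomputable def cell (δ : ℝ) : ℕ → Set Plane :=
  disjointed fun n => Metric.ball (TopologicalSpace.denseSeq Plane n) (δ / 3)

theorem measurableSet_cell (δ : ℝ) (n : ℕ) : MeasurableSet (cell δ n) :=
  MeasurableSet.disjointed (fun _ => measurableSet_ball) n

theorem dist_lt_of_mem_cell {δ : ℝ} (hδ : 0 < δ) {n : ℕ} {x y : Plane} (hx : x ∈ cell δ n)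
    (hy : y ∈ cell δ n) : dist x y < δ := by
  have hx' := Metric.mem_ball.1 (disjointed_subset _ n hx)
  have hy' := Metric.mem_ball.1 (disjointed_subset _ n hy)
  have := dist_triangle_right x y (TopologicalSpace.denseSeq Plane n)
  linarith

theorem exists_mem_cell {δ : ℝ} (hδ : 0 < δ) (x : Plane) : ∃ n, x ∈ cell δ n := by
  have h : x ∈ ⋃ n, cell δ n := by
    unfold cell
    rw [iUnion_disjointed, Set.mem_iUnion]
    exact (TopologicalSpace.denseRange_denseSeq Plane).exists_dist_lt x
      (show 0 < δ / 3 by positivity)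
  exact Set.mem_iUnion.1 h

theorem eq_of_mem_cell {δ : ℝ} {m n : ℕ} {x : Plane} (hm : x ∈ cell δ m) (hn : x ∈ cell δ n) :
    m = n := by
  by_contra h
  exact Set.disjoint_left.1 (disjoint_disjointed _ h) hm hn

/-- The point with label `k` is present and lies in cell `n`. -/
def InCell (δ : ℝ) (g : Ground) (n k : ℕ) : Prop := (g k).1 = true ∧ (g k).2 ∈ cell δ n

theorem exists_first (δ : ℝ) (g : Ground) (n : ℕ) :
    ∃ k, InCell δ g n k ∨ ∀ j, ¬ InCell δ g n j := by
  by_cases h : ∃ k, InCell δ g n k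
  · exact h.imp fun k hk => Or.inl hk
  · exact ⟨0, Or.inr (not_exists.1 h)⟩

open scoped Classical in
/-- The configuration relabelled by the cells: the label `n` is in use iff cell `n` is occupied, and
then it carries the first point in the cell. -/
noncomputable def canon (δ : ℝ) (g : Ground) : Ground := fun n =>
  if InCell δ g n (Nat.find (exists_first δ g n)) then (true, (g (Nat.find (exists_first δ g n))).2)
  else (false, 0)

theorem canon_spec (δ : ℝ) (g : Ground) (n : ℕ) :
    (∃ k, InCell δ g n k ∧ canon δ g n = (true, (g k).2)) ∨
      ((∀ k, ¬ InCell δ g n k) ∧ canon δ g n = (false, 0)) := by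
  classical
  unfold canon
  rcases Nat.find_spec (exists_first δ g n) with h | h
  · exact Or.inl ⟨_, h, if_pos h⟩
  · exact Or.inr ⟨h, if_neg (h _)⟩

theorem measurableSet_inCell (δ : ℝ) (n k : ℕ) : MeasurableSet {g : Ground | InCell δ g n k} :=
  (D2DParams.measurableSet_present k).inter
    ((measurable_snd.comp (measurable_pi_apply k)) (measurableSet_cell δ n))

theorem measurable_canon (δ : ℝ) : Measurable (canon δ) := by
  classical
  refine measurable_pi_lambda _ fun n => ?_
  refine Measurable.find (f := fun k g => if InCell δ g n k then (true, (g k).2) else (false, 0))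
    (fun k => ?_) (fun k => ?_) (fun g => exists_first δ g n)
  · exact Measurable.ite (measurableSet_inCell δ n k) (by fun_prop) measurable_const
  · have : {g : Ground | ∀ j, ¬ InCell δ g n j} = ⋂ j, {g | InCell δ g n j}ᶜ := by ext; simp
    refine (measurableSet_inCell δ n k).union (?_ : MeasurableSet {g | ∀ j, ¬ InCell δ g n j})
    rw [this]
    exact MeasurableSet.iInter fun j => (measurableSet_inCell δ n j).compl

theorem HardCore.eq_of_inCell {δ : ℝ} (hδ : 0 < δ) {g : Ground} (hg : g.HardCore δ) {n j k : ℕ}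
    (hj : InCell δ g n j) (hk : InCell δ g n k) : j = k := by
  by_contra h
  exact absurd (hg j k h hj.1 hk.1) (not_le.2 (dist_lt_of_mem_cell hδ hj.2 hk.2))

/-- The points of a hard-core configuration and of its canonical relabelling correspond to each
other. -/
theorem HardCore.exists_equiv_canon {δ : ℝ} (hδ : 0 < δ) {g : Ground} (hg : g.HardCore δ) :
    ∃ e : {j // (canon δ g j).1 = true} ≃ {j // (g j).1 = true},
      ∀ j, (g (e j)).2 = (canon δ g j).2 := by
  have h (n : {j // (canon δ g j).1 = true}) :
      ∃ k, InCell δ g n k ∧ canon δ g n = (true, (g k).2) := by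
    rcases canon_spec δ g n with h | h
    · exact h
    · have := n.2
      rw [h.2] at this
      exact absurd this (by simp)
  choose f hf using h
  refine ⟨Equiv.ofBijective (fun n => ⟨f n, (hf n).1.1⟩) ⟨fun m n hmn => ?_, fun k => ?_⟩,
    fun n => by rw [(hf n).2]; rfl⟩
  · have h1 : f m = f n := congrArg Subtype.val hmn
    refine Subtype.ext (eq_of_mem_cell (hf m).1.2 ?_)
    rw [h1]
    exact (hf n).1.2
  · obtain ⟨n, hn⟩ := exists_mem_cell hδ (g k).2
    have hk : InCell δ g n k := ⟨k.2, hn⟩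
    have hp : (canon δ g n).1 = true := by
      rcases canon_spec δ g n with ⟨j, _, hj⟩ | h
      · rw [hj]
      · exact absurd hk (h.1 k)
    exact ⟨⟨n, hp⟩, Subtype.ext (hg.eq_of_inCell hδ (hf ⟨n, hp⟩).1 hk)⟩

theorem count_eq_zero_iff (g : Ground) (B : Set Plane) :
    g.count B = 0 ↔ ∀ k, ¬ ((g k).1 = true ∧ (g k).2 ∈ B) := by
  unfold count
  rw [Set.encard_eq_zero, Set.eq_empty_iff_forall_notMem]
  rfl

/-- The content of a cell is determined by the counts. -/
theorem HardCore.canon_mem_iff {δ : ℝ} (hδ : 0 < δ) {g : Ground} (hg : g.HardCore δ) (n : ℕ)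
    (A : Set (Bool × Plane)) : canon δ g n ∈ A ↔
      g.count (cell δ n ∩ {x | (true, x) ∈ A}) ≠ 0 ∨ (g.count (cell δ n) = 0 ∧ (false, 0) ∈ A) := by
  rw [ne_eq, count_eq_zero_iff, count_eq_zero_iff]
  push Not
  rcases canon_spec δ g n with ⟨k, hk, h⟩ | ⟨hn, h⟩ <;> rw [h]
  · constructor
    · exact fun hA => Or.inl ⟨k, hk.1, hk.2, hA⟩
    · rintro (⟨j, hj, hjn, hjA⟩ | ⟨h0, _⟩)
      · rwa [hg.eq_of_inCell hδ hk ⟨hj, hjn⟩]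
      · exact absurd hk.2 (h0 k hk.1)
  · constructor
    · exact fun hA => Or.inr ⟨fun k hk hkn => hn k ⟨hk, hkn⟩, hA⟩
    · rintro (⟨j, hj, hjn, _⟩ | ⟨_, hA⟩)
      · exact absurd ⟨hj, hjn⟩ (hn j)
      · exact hA

theorem HardCore.shift {δ : ℝ} {g : Ground} (hg : g.HardCore δ) (t : Plane) :
    (g.shift t).HardCore δ := fun j k hjk hj hk => by
  have := hg j k hjk hj hk
  rwa [← dist_add_right _ _ t] at this

theorem measurable_shift (t : Plane) : Measurable (Ground.shift t) := by
  unfold Ground.shift; fun_prop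

theorem count_toENNReal (g : Ground) (B : Set Plane) [DecidablePred (· ∈ B)] :
    ((g.count B : ℕ∞) : ℝ≥0∞) =
      ∑' k, if (g k).1 = true ∧ (g k).2 ∈ B then (1 : ℝ≥0∞) else 0 := by
  unfold count
  rw [← ENNReal.tsum_set_one, tsum_subtype _ fun _ => (1 : ℝ≥0∞)]
  exact tsum_congr fun k => by simp [Set.indicator]

theorem measurable_count {B : Set Plane} (hB : MeasurableSet B) :
    Measurable fun g : Ground => g.count B := by
  classical
  have h : Measurable fun g : Ground => ((g.count B : ℕ∞) : ℝ≥0∞) := by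
    have : (fun g : Ground => ((g.count B : ℕ∞) : ℝ≥0∞)) =
        fun g => ∑' k, if (g k).1 = true ∧ (g k).2 ∈ B then (1 : ℝ≥0∞) else 0 := by
      exact funext fun g => g.count_toENNReal B
    rw [this]
    refine Measurable.tsum fun k => Measurable.ite ?_ measurable_const measurable_const
    exact (D2DParams.measurableSet_present k).inter
      ((measurable_snd.comp (measurable_pi_apply k)) hB)
  refine measurable_to_countable' fun m => ?_
  have : (fun g : Ground => g.count B) ⁻¹' {m} =
      (fun g : Ground => ((g.count B : ℕ∞) : ℝ≥0∞)) ⁻¹' {(m : ℝ≥0∞)} := by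
    ext g; simp
  rw [this]
  exact h (measurableSet_singleton _)

end Ground

namespace IsHardCoreProcess

variable {Q : Measure Ground} {lamP δ : ℝ}

theorem ae_hardCore (hQ : IsHardCoreProcess Q lamP δ) : ∀ᵐ g ∂Q, Ground.HardCore δ g :=
  hQ.clearance

/-- The law of the canonical relabelling is invariant under translations: its finite-dimensional
events are events about the counts of finitely many sets. -/
theorem map_canon_shift (hQ : IsHardCoreProcess Q lamP δ) (hδ : 0 < δ) (t : Plane) :
    Q.map (fun g => Ground.canon δ (g.shift t)) = Q.map (Ground.canon δ) := by
  have := hQ.isProbabilityMeasure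
  have hm1 : Measurable fun g : Ground => Ground.canon δ (g.shift t) :=
    (Ground.measurable_canon δ).comp (Ground.measurable_shift t)
  have hm2 := Ground.measurable_canon δ
  have := Measure.isProbabilityMeasure_map hm1.aemeasurable (μ := Q)
  have := Measure.isProbabilityMeasure_map hm2.aemeasurable (μ := Q)
  refine ext_of_generate_finite _
    (generateFrom_squareCylinders (α := fun _ : ℕ => Bool × Plane)).symm
    (isPiSystem_squareCylinders (fun _ => MeasurableSpace.isPiSystem_measurableSet) (by simp)) ?_
    (by simp)
  rintro _ ⟨s, A, hA, rfl⟩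
  have hA' : ∀ i, MeasurableSet (A i) := fun i => hA i (Set.mem_univ i)
  have hs : MeasurableSet ((s : Set ℕ).pi A) := .pi s.countable_toSet fun i _ => hA' i
  obtain ⟨N, hN⟩ := s.bddAbove
  -- cell `n` is described by two counts: the points with position in `A n`, and all the points
  let B : Fin ((N + 1) + (N + 1)) → Set Plane := Fin.append
    (fun n => Ground.cell δ n ∩ {x | (true, x) ∈ A n}) (fun n => Ground.cell δ n)
  have hB (i) : MeasurableSet (B i) := by
    refine Fin.addCases (fun n => ?_) (fun n => ?_) i
    · simp only [B, Fin.append_left]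
      exact (Ground.measurableSet_cell δ n).inter (measurable_prodMk_left (hA' n))
    · simp only [B, Fin.append_right]
      exact Ground.measurableSet_cell δ n
  let E : Set (Fin ((N + 1) + (N + 1)) → ℕ∞) := {c | ∀ n : Fin (N + 1), (n : ℕ) ∈ s →
    c (Fin.castAdd _ n) ≠ 0 ∨ (c (Fin.natAdd _ n) = 0 ∧ (false, 0) ∈ A n)}
  have hE : MeasurableSet E := (Set.to_countable E).measurableSet
  have key (g : Ground) (hg : g.HardCore δ) :
      Ground.canon δ g ∈ (s : Set ℕ).pi A ↔ (fun i => g.count (B i)) ∈ E := by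
    simp only [Set.mem_pi, hg.canon_mem_iff hδ, E, B, Set.mem_ofPred_eq, Fin.append_left,
      Fin.append_right]
    exact ⟨fun h n hn => h n hn, fun h n hn => h ⟨n, Nat.lt_succ_of_le (hN hn)⟩ hn⟩
  have hc : Measurable fun (g : Ground) i => g.count (B i) :=
    measurable_pi_lambda _ fun i => Ground.measurable_count (hB i)
  rw [Measure.map_apply hm1 hs, Measure.map_apply hm2 hs]
  calc Q ((fun g => Ground.canon δ (g.shift t)) ⁻¹' (s : Set ℕ).pi A)
      = Q ((fun g i => (g.shift t).count (B i)) ⁻¹' E) := by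
        refine measure_congr ?_
        filter_upwards [hQ.ae_hardCore] with g hg
        exact propext (key _ (hg.shift t))
    _ = Q ((fun g i => g.count (B i)) ⁻¹' E) := by
        have h : Q.map (fun g i => (g.shift t).count (B i)) E =
            Q.map (fun g i => g.count (B i)) E := by rw [hQ.stationary t _ B hB]
        have hc' : Measurable fun (g : Ground) i => (g.shift t).count (B i) :=
          hc.comp (Ground.measurable_shift t)
        rwa [Measure.map_apply hc hE, Measure.map_apply hc' hE] at h
    _ = Q (Ground.canon δ ⁻¹' (s : Set ℕ).pi A) := by
        refine measure_congr ?_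
        filter_upwards [hQ.ae_hardCore] with g hg
        exact propext (key _ hg).symm

/-- Stationarity for functionals that do not depend on the labelling. -/
theorem lintegral_shift (hQ : IsHardCoreProcess Q lamP δ) (hδ : 0 < δ) (t : Plane)
    {H : Ground → ℝ≥0∞} (hH : Measurable H)
    (hlabel : ∀ g, Ground.HardCore δ g → H (Ground.canon δ g) = H g) :
    ∫⁻ g, H (g.shift t) ∂Q = ∫⁻ g, H g ∂Q := by
  have hm1 : Measurable fun g : Ground => Ground.canon δ (g.shift t) :=
    (Ground.measurable_canon δ).comp (Ground.measurable_shift t)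
  calc ∫⁻ g, H (g.shift t) ∂Q = ∫⁻ g, H (Ground.canon δ (g.shift t)) ∂Q := by
        refine lintegral_congr_ae ?_
        filter_upwards [hQ.ae_hardCore] with g hg
        exact (hlabel _ (hg.shift t)).symm
    _ = ∫⁻ g, H (Ground.canon δ g) ∂Q := by
        rw [← lintegral_map hH hm1, hQ.map_canon_shift hδ t,
          lintegral_map hH (Ground.measurable_canon δ)]
    _ = ∫⁻ g, H g ∂Q := by
        refine lintegral_congr_ae ?_
        filter_upwards [hQ.ae_hardCore] with g hg
        exact hlabel _ hg

end IsHardCoreProcess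

/-! ### Campbell's formula -/

theorem unitSquare_eq : unitSquare =
    (MeasurableEquiv.toLp 2 (Fin 2 → ℝ)).symm ⁻¹' Set.univ.pi fun _ => Set.Ico (0 : ℝ) 1 := by
  ext x
  simp only [unitSquare, Set.mem_ofPred_eq, Set.mem_preimage, Set.mem_univ_pi]
  rfl

theorem measurableSet_unitSquare : MeasurableSet unitSquare := by
  rw [unitSquare_eq]
  exact (MeasurableEquiv.measurable _) (MeasurableSet.univ_pi fun _ => measurableSet_Ico)

theorem volume_unitSquare : volume unitSquare = 1 := by
  rw [unitSquare_eq, (EuclideanSpace.volume_preserving_symm_measurableEquiv_toLp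
    (Fin 2)).measure_preimage (MeasurableSet.univ_pi fun _ => measurableSet_Ico).nullMeasurableSet,
    volume_pi_pi]
  simp

namespace D2DParams

variable {L M : ℕ} (p : D2DParams L M) {Q : Measure Ground} {lamP δ : ℝ}

open scoped Classical in
/-- The number of points in `B`, each weighted by its conditional probability of success. -/
noncomputable def successCount (n s : ℕ) (D : Plane) (B : Set Plane) (g : Ground) : ℝ≥0∞ :=
  ∑' k, if (g k).1 = true ∧ (g k).2 ∈ B then p.successAt g k n s D else 0

theorem measurableSet_present_mem (k : ℕ) {B : Set Plane} (hB : MeasurableSet B) :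
    MeasurableSet {g : Ground | (g k).1 = true ∧ (g k).2 ∈ B} :=
  (measurableSet_present k).inter ((measurable_snd.comp (measurable_pi_apply k)) hB)

theorem measurable_successCount (n s : ℕ) (D : Plane) {B : Set Plane} (hB : MeasurableSet B) :
    Measurable (p.successCount n s D B) :=
  Measurable.tsum fun k => Measurable.ite (measurableSet_present_mem k hB)
    (p.measurable_successAt_left D k n s) measurable_const

theorem successCount_le (n s : ℕ) (D : Plane) (B : Set Plane) (g : Ground) :
    p.successCount n s D B g ≤ g.count B := by
  classical
  rw [Ground.count_toENNReal]
  refine ENNReal.tsum_le_tsum fun k => ?_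
  split_ifs
  · exact p.successAt_le_one g k n s D
  · exact le_rfl

/-- `successCount` is a functional of the unlabelled configuration. -/
theorem successCount_canon (n s : ℕ) (D : Plane) (B : Set Plane) (hδ : 0 < δ) {g : Ground}
    (hg : g.HardCore δ) : p.successCount n s D B (g.canon δ) = p.successCount n s D B g := by
  classical
  have h (g : Ground) : p.successCount n s D B g =
      ∑' k : {k // (g k).1 = true}, if (g k).2 ∈ B then p.successAt g k n s D else 0 := by
    change _ = ∑' k : {k | (g k).1 = true}, if (g k).2 ∈ B then p.successAt g k n s D else 0
    rw [tsum_subtype {k | (g k).1 = true}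
      fun k => if (g k).2 ∈ B then p.successAt g k n s D else 0]
    refine tsum_congr fun k => ?_
    by_cases hk : (g k).1 = true <;> simp [Set.indicator, hk]
  obtain ⟨e, he⟩ := hg.exists_equiv_canon hδ
  rw [h g, h (g.canon δ), ← e.tsum_eq]
  refine tsum_congr fun k => ?_
  rw [he, p.successAt_relabel e he]

theorem successCount_shift (n s : ℕ) (D t : Plane) (B : Set Plane) (g : Ground) :
    p.successCount n s D B (g.shift t) = p.successCount n s D {x | x + t ∈ B} g := by
  classical
  unfold successCount
  refine tsum_congr fun k => ?_
  rw [p.successAt_shift]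
  rfl

/-- The intensity measure of the points weighted by their conditional probabilities of success. -/
noncomputable def successMeasure (Q : Measure Ground) (n s : ℕ) (D : Plane) : Measure Plane :=
  Measure.sum fun k => ((Q.withDensity fun g => p.successAt g k n s D).restrict
    {g | (g k).1 = true}).map fun g => (g k).2

theorem successMeasure_apply (Q : Measure Ground) (n s : ℕ) (D : Plane) {B : Set Plane}
    (hB : MeasurableSet B) :
    p.successMeasure Q n s D B = ∫⁻ g, p.successCount n s D B g ∂Q := by
  classical
  unfold successMeasure successCount
  rw [Measure.sum_apply _ hB, lintegral_tsum fun k => (Measurable.ite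
    (measurableSet_present_mem k hB) (p.measurable_successAt_left D k n s)
    measurable_const).aemeasurable]
  refine tsum_congr fun k => ?_
  have hx : Measurable fun g : Ground => (g k).2 := measurable_snd.comp (measurable_pi_apply k)
  rw [Measure.map_apply hx hB, Measure.restrict_apply (hx hB), Set.inter_comm]
  have hset := measurableSet_present_mem k hB
  change (Q.withDensity fun g => p.successAt g k n s D) {g | (g k).1 = true ∧ (g k).2 ∈ B} = _
  rw [withDensity_apply _ hset, ← lintegral_indicator hset]
  refine lintegral_congr fun g => ?_
  by_cases h : (g k).1 = true ∧ (g k).2 ∈ B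
  · exact (Set.indicator_of_mem (s := {g : Ground | (g k).1 = true ∧ (g k).2 ∈ B}) h _).trans
      (if_pos h).symm
  · exact (Set.indicator_of_notMem (s := {g : Ground | (g k).1 = true ∧ (g k).2 ∈ B}) h _).trans
      (if_neg h).symm

/-- Campbell's formula: by stationarity, the intensity measure is a multiple of the area. -/
theorem lintegral_successCount (hQ : IsHardCoreProcess Q lamP δ) (hδ : 0 < δ) (n s : ℕ) (D : Plane)
    {B : Set Plane} (hB : MeasurableSet B) :
    ∫⁻ g, p.successCount n s D B g ∂Q =
      volume B * ∫⁻ g, p.successCount n s D unitSquare g ∂Q := by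
  set ν := p.successMeasure Q n s D with hν
  have hfin : IsFiniteMeasureOnCompacts ν := ⟨fun K hK => by
    rw [hν, p.successMeasure_apply Q n s D hK.measurableSet]
    calc ∫⁻ g, p.successCount n s D K g ∂Q ≤ ∫⁻ g, (g.count K : ℝ≥0∞) ∂Q :=
          lintegral_mono fun g => p.successCount_le n s D K g
      _ = ENNReal.ofReal lamP * volume K := hQ.intensity K hK.measurableSet
      _ < ∞ := ENNReal.mul_lt_top ENNReal.ofReal_lt_top hK.measure_lt_top⟩
  have hinv : ν.IsAddLeftInvariant := ⟨fun t => by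
    refine Measure.ext fun A hA => ?_
    have hA' : MeasurableSet {x | x + t ∈ A} := (measurable_add_const t) hA
    have h1 : (fun x => t + x) ⁻¹' A = {x | x + t ∈ A} := by
      ext x
      simp only [Set.mem_preimage, Set.mem_ofPred_eq, add_comm]
    rw [Measure.map_apply (measurable_const_add t) hA, h1, hν,
      p.successMeasure_apply Q n s D hA', p.successMeasure_apply Q n s D hA]
    simp only [← successCount_shift]
    exact hQ.lintegral_shift hδ t (p.measurable_successCount n s D hA)
      fun g hg => p.successCount_canon n s D A hδ hg⟩
  have h := Measure.isAddLeftInvariant_eq_smul ν volume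
  rw [← p.successMeasure_apply Q n s D hB,
    ← p.successMeasure_apply Q n s D measurableSet_unitSquare, ← hν, h]
  simp only [Measure.smul_apply, volume_unitSquare]
  rw [ENNReal.smul_def, ENNReal.smul_def, smul_eq_mul, smul_eq_mul, mul_one, mul_comm]

end D2DParams

/-! ### Integration with respect to the Palm distribution -/

theorem lintegral_poissonMeasure_id (r : ℝ≥0) :
    ∫⁻ n, (n : ℝ≥0∞) ∂poissonMeasure r = r := by
  have h1 : ∑' n : ℕ, ENNReal.ofReal (Real.exp (-r) * r ^ n / (n.factorial : ℝ)) = 1 := by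
    rw [← ENNReal.ofReal_tsum_of_nonneg (fun n => by positivity)
      (hasSum_one_poissonMeasure r).summable, (hasSum_one_poissonMeasure r).tsum_eq,
      ENNReal.ofReal_one]
  rw [poissonMeasure, lintegral_sum_measure]
  simp only [lintegral_smul_measure, lintegral_dirac, smul_eq_mul]
  rw [tsum_eq_zero_add' ENNReal.summable]
  have h2 (n : ℕ) : ENNReal.ofReal (Real.exp (-r) * r ^ (n + 1) / ((n + 1).factorial : ℝ)) *
      ((n + 1 : ℕ) : ℝ≥0∞) =
      r * ENNReal.ofReal (Real.exp (-r) * r ^ n / (n.factorial : ℝ)) := by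
    rw [← ENNReal.ofReal_natCast, ← ENNReal.ofReal_coe_nnreal, ← ENNReal.ofReal_mul (by positivity),
      ← ENNReal.ofReal_mul (by positivity)]
    congr 1
    rw [Nat.factorial_succ]
    push_cast
    field_simp
    ring
  simp only [h2, ENNReal.tsum_mul_left, h1]
  simp

namespace D2DParams

variable {L M : ℕ} (p : D2DParams L M) {Q : Measure Ground} {lamP δ : ℝ}

open scoped Classical in
/-- Integration of a translation invariant functional with respect to the Palm distribution. -/
theorem lintegral_palm [SFinite Q] {f : ℕ → Network L M → ℝ≥0∞} (hf : ∀ k, Measurable (f k))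
    (hshift : ∀ k ω t, f k (ω.shift t) = f k ω) :
    ∫⁻ z, f z.1 z.2 ∂p.palm Q lamP = (ENNReal.ofReal lamP)⁻¹ *
      ∫⁻ g, ∑' k, (if (g k).1 = true ∧ (g k).2 ∈ unitSquare then
        ∫⁻ z, f k (g, z) ∂p.randomnessLaw else 0) ∂Q := by
  have hfz : Measurable fun z : ℕ × Network L M => f z.1 z.2 :=
    measurable_from_prod_countable_right hf
  have hcoord (k : ℕ) : Measurable fun ω : Network L M => (k, ω.shift (-ω.center k)) := by
    unfold Network.shift Ground.shift Network.center
    fun_prop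
  have hset (k : ℕ) := measurableSet_present_mem k measurableSet_unitSquare
  unfold palm
  rw [lintegral_smul_measure, lintegral_sum_measure, smul_eq_mul, lintegral_tsum]
  · congr 1
    refine tsum_congr fun k => ?_
    rw [lintegral_map hfz (hcoord k)]
    simp only [hshift]
    have hset' : MeasurableSet {ω : Network L M | ω.Present k ∧ ω.center k ∈ unitSquare} :=
      measurable_fst (hset k)
    rw [← lintegral_indicator hset']
    change ∫⁻ ω, _ ∂(Q.prod p.randomnessLaw) = _
    rw [lintegral_prod _ ((hf k).indicator hset').aemeasurable]
    refine lintegral_congr fun g => ?_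
    by_cases h : (g k).1 = true ∧ (g k).2 ∈ unitSquare
    · rw [if_pos h]
      exact lintegral_congr fun z => Set.indicator_of_mem
        (s := {ω : Network L M | ω.Present k ∧ ω.center k ∈ unitSquare}) h _
    · rw [if_neg h, ← lintegral_zero (μ := p.randomnessLaw)]
      exact lintegral_congr fun z => Set.indicator_of_notMem
        (s := {ω : Network L M | ω.Present k ∧ ω.center k ∈ unitSquare}) h _
  · intro k
    exact (Measurable.ite (hset k) (hf k).lintegral_prod_right' measurable_const).aemeasurable

theorem served_shift (ω : Network L M) (t : Plane) (k i : ℕ) :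
    p.Served (ω.shift t) k i ↔ p.Served ω k i := by
  unfold Served
  rw [interference_shift]
  rfl

theorem success_shift (ω : Network L M) (t : Plane) (k n s : ℕ) :
    p.success (ω.shift t) k n s = p.success ω k n s := by
  simp only [success, interference_shift]

theorem measurable_mark (k : ℕ) : Measurable fun ω : Network L M => ω.mark k :=
  (measurable_pi_apply k).comp (measurable_fst.comp measurable_snd)

theorem measurable_success (k n s : ℕ) : Measurable fun ω : Network L M => p.success ω k n s := by
  have : Measurable fun q : (Network L M × Plane) × Plane => p.gainCcdf q.1.2 q.2
      (p.threshold n (p.interference q.1.1 k 0 q.2 n s)) :=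
    p.measurable_gainCcdf_comp (by fun_prop) (by fun_prop) ((p.measurable_threshold n).comp
      (p.measurable_interference_comp (by fun_prop) (by fun_prop) k 0 n s))
  exact this.lintegral_prod_right'.lintegral_prod_right'

theorem measurable_sum_range_Nr (k : ℕ) {f : ℕ → Network L M → ℝ≥0∞} (hf : ∀ i, Measurable (f i)) :
    Measurable fun ω : Network L M => ∑ i ∈ Finset.range (ω.mark k).Nr, f i ω :=
  measurable_of_countable_cases (Mark.measurable_Nr.comp (measurable_mark k))
    (F := fun N ω => ∑ i ∈ Finset.range N, f i ω)
    fun _ => Finset.measurable_sum _ fun i _ => hf i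

/-- The mean number of served requests, given the ground process `g`, of cluster `k`, where requests
in a cluster with `N` matches have the weight `a N`. -/
noncomputable def meanServed (slot : ℕ → ℕ) (a : ℕ → ℝ≥0∞) (g : Ground) (k : ℕ) : ℝ≥0∞ :=
  ∫⁻ m, (p.numScheduled m.Nm : ℝ≥0∞) * ∫⁻ D, a m.Nm *
    p.successAt g k (p.slots m.Nm) (slot (p.slots m.Nm)) D ∂p.unifDisc ∂p.markLaw

open scoped Classical in
/-- The mean over the typical cluster of the served requests, as an integral over the ground
process. -/
theorem lintegral_palm_served [SFinite Q] (a : ℕ → ℝ≥0∞) {slot : ℕ → ℕ}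
    (hslot : ∀ n, 1 ≤ n → slot n < n) :
    ∫⁻ z, ∑ i ∈ Finset.range (z.2.mark z.1).Nr,
        (if p.Served z.2 z.1 i then a (z.2.mark z.1).Nm else 0) ∂p.palm Q lamP =
      (ENNReal.ofReal lamP)⁻¹ * ∫⁻ g, ∑' k, (if (g k).1 = true ∧ (g k).2 ∈ unitSquare then
        p.meanServed slot a g k else 0) ∂Q := by
  rw [p.lintegral_palm (f := fun k ω => ∑ i ∈ Finset.range (ω.mark k).Nr,
    (if p.Served ω k i then a (ω.mark k).Nm else 0))]
  · congr 1
    refine lintegral_congr fun g => tsum_congr fun k => ?_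
    have h := p.lintegral_sum_served g k (u := fun N _ => a N) (fun _ => measurable_const) hslot
    rw [meanServed, ← h]
    rfl
  · exact fun k => measurable_sum_range_Nr k fun i => Measurable.ite (p.measurableSet_served k i)
      ((measurable_from_nat (f := a)).comp (Mark.measurable_Nm.comp (measurable_mark k)))
      measurable_const
  · intro k ω t
    simp only [served_shift]
    rfl

open scoped Classical in
/-- The scheduled requests of the typical cluster are served with the probability `success`, where
the weights may depend on the number of matches. -/
theorem lintegral_palm_served_eq_success [SFinite Q] (a : ℕ → ℝ≥0∞) {slot : ℕ → ℕ}
    (hslot : ∀ n, 1 ≤ n → slot n < n) :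
    ∫⁻ z, ∑ i ∈ Finset.range (z.2.mark z.1).Nr,
        (if p.Served z.2 z.1 i then a (z.2.mark z.1).Nm else 0) ∂p.palm Q lamP =
      ∫⁻ z, a (z.2.mark z.1).Nm * (p.numScheduled (z.2.mark z.1).Nm : ℝ≥0∞) *
        p.success z.2 z.1 (p.slots (z.2.mark z.1).Nm) (slot (p.slots (z.2.mark z.1).Nm))
          ∂p.palm Q lamP := by
  rw [p.lintegral_palm_served a hslot, p.lintegral_palm (f := fun k ω => a (ω.mark k).Nm *
    (p.numScheduled (ω.mark k).Nm : ℝ≥0∞) *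
    p.success ω k (p.slots (ω.mark k).Nm) (slot (p.slots (ω.mark k).Nm)))]
  · congr 1
    refine lintegral_congr fun g => tsum_congr fun k => ?_
    have h := p.lintegral_mul_success g k (fun N => a N * (p.numScheduled N : ℝ≥0∞)) slot
    have h' : p.meanServed slot a g k = ∫⁻ m, a m.Nm * (p.numScheduled m.Nm : ℝ≥0∞) * ∫⁻ D,
        p.successAt g k (p.slots m.Nm) (slot (p.slots m.Nm)) D ∂p.unifDisc ∂p.markLaw := by
      refine lintegral_congr fun m => ?_
      rw [lintegral_const_mul _ (p.measurable_successAt_right g k _ _), ← mul_assoc,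
        mul_comm (a m.Nm)]
    rw [h', ← h]
    rfl
  · exact fun k => measurable_of_countable_cases (Mark.measurable_Nm.comp (measurable_mark k))
      (F := fun N ω => a N * (p.numScheduled N : ℝ≥0∞) *
        p.success ω k (p.slots N) (slot (p.slots N)))
      fun N => (p.measurable_success k _ _).const_mul _
  · intro k ω t
    simp only [success_shift]
    rfl

theorem lintegral_markLaw_Nr : ∫⁻ m : Mark L M, (m.Nr : ℝ≥0∞) ∂p.markLaw =
    ENNReal.ofReal p.lamR * volume (Metric.ball (0 : Plane) p.Rc) := by
  have : IsProbabilityMeasure choiceLaw := by unfold choiceLaw; infer_instance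
  have : IsProbabilityMeasure p.videoLaw := by unfold videoLaw; infer_instance
  have h : MeasurePreserving (fun m : Mark L M => m.1.2) p.markLaw
      (poissonMeasure (p.lamR * (Real.pi * p.Rc ^ 2)).toNNReal) :=
    measurePreserving_snd.comp (measurePreserving_fst (μ := p.countLaw)
      (ν := p.videoLaw.prod (p.positionGainLaw.prod
        (choiceLaw.prod (Measure.infinitePi fun _ : ℕ => p.unifDisc)))))
  have hR := p.Rc_pos
  have hl := p.lamR_pos
  rw [EuclideanSpace.volume_ball_fin_two, ← ENNReal.ofReal_pow hR.le,
    ← ENNReal.ofReal_mul (by positivity), ← ENNReal.ofReal_mul hl.le, mul_comm (p.Rc ^ 2)]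
  exact (h.lintegral_comp (f := fun n : ℕ => (n : ℝ≥0∞)) measurable_from_nat).trans
    (lintegral_poissonMeasure_id _)

/-- The typical cluster has `lamR * π * Rc ^ 2` requesting users on average, since the Palm
distribution has mass one and does not bias the marks. -/
theorem lintegral_palm_Nr (hQ : IsHardCoreProcess Q lamP δ) (hlamP : 0 < lamP) :
    ∫⁻ z, ((z.2.mark z.1).Nr : ℝ≥0∞) ∂p.palm Q lamP =
      ENNReal.ofReal p.lamR * volume (Metric.ball (0 : Plane) p.Rc) := by
  classical
  have := hQ.isProbabilityMeasure
  rw [p.lintegral_palm (f := fun k ω => ((ω.mark k).Nr : ℝ≥0∞))]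
  · have h (g : Ground) (k : ℕ) : ∫⁻ z, ((Network.mark (g, z) k).Nr : ℝ≥0∞) ∂p.randomnessLaw =
        ENNReal.ofReal p.lamR * volume (Metric.ball (0 : Plane) p.Rc) := by
      rw [← p.lintegral_markLaw_Nr]
      have h1 : MeasurePreserving (fun z : Randomness L M => z.1 k) p.randomnessLaw p.markLaw :=
        (measurePreserving_eval_infinitePi (fun _ : ℕ => p.markLaw) k).comp measurePreserving_fst
      exact h1.lintegral_comp (f := fun m : Mark L M => (m.Nr : ℝ≥0∞))
        ((measurable_from_nat (f := fun n : ℕ => (n : ℝ≥0∞))).comp Mark.measurable_Nr)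
    simp only [h]
    set c := ENNReal.ofReal p.lamR * volume (Metric.ball (0 : Plane) p.Rc) with hc
    have h2 : ∫⁻ g : Ground, ∑' k, (if (g k).1 = true ∧ (g k).2 ∈ unitSquare then c else 0) ∂Q =
        c * ∫⁻ g, (g.count unitSquare : ℝ≥0∞) ∂Q := by
      rw [← lintegral_const_mul]
      · refine lintegral_congr fun g => ?_
        rw [Ground.count_toENNReal, ← ENNReal.tsum_mul_left]
        simp only [mul_ite, mul_one, mul_zero]
      · exact (measurable_of_countable fun n : ℕ∞ => (n : ℝ≥0∞)).comp
          (Ground.measurable_count measurableSet_unitSquare)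
    have hl : ENNReal.ofReal lamP ≠ 0 := by simpa using hlamP
    rw [h2, hQ.intensity _ measurableSet_unitSquare, volume_unitSquare, mul_one, mul_comm c,
      ← mul_assoc, ENNReal.inv_mul_cancel hl ENNReal.ofReal_ne_top, one_mul]
  · exact fun k => (measurable_from_nat (f := fun n : ℕ => (n : ℝ≥0∞))).comp
      (Mark.measurable_Nr.comp (measurable_mark k))
  · exact fun k ω t => rfl

/-! ### The global metric -/

open scoped Classical in
/-- Fubini for the sum over the clusters of the mean numbers of served requests. -/
theorem lintegral_tsum_meanServed [SFinite Q] (slot : ℕ → ℕ) {C : Set (Plane × Plane)}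
    (hC : MeasurableSet C) :
    ∫⁻ g, ∑' k, ∫⁻ m, (p.numScheduled m.Nm : ℝ≥0∞) * ∫⁻ D,
        (if (g k).1 = true ∧ ((g k).2, D) ∈ C then
          p.successAt g k (p.slots m.Nm) (slot (p.slots m.Nm)) D else 0)
        ∂p.unifDisc ∂p.markLaw ∂Q =
      ∫⁻ m, (p.numScheduled m.Nm : ℝ≥0∞) * ∫⁻ D, ∫⁻ g, p.successCount (p.slots m.Nm)
        (slot (p.slots m.Nm)) D {x | (x, D) ∈ C} g ∂Q ∂p.unifDisc ∂p.markLaw := by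
  have hmem (k : ℕ) : MeasurableSet {q : Ground × Plane | (q.1 k).1 = true ∧ ((q.1 k).2, q.2) ∈ C} :=
    ((measurableSet_present k).preimage measurable_fst).inter
      (hC.preimage (f := fun q : Ground × Plane => ((q.1 k).2, q.2)) (by fun_prop))
  have hk (k n s : ℕ) : Measurable fun q : Ground × Plane =>
      if (q.1 k).1 = true ∧ ((q.1 k).2, q.2) ∈ C then p.successAt q.1 k n s q.2 else 0 :=
    Measurable.ite (hmem k) (p.measurable_successAt k n s) measurable_const
  have hcount (n s : ℕ) : Measurable fun q : Ground × Plane =>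
      p.successCount n s q.2 {x | (x, q.2) ∈ C} q.1 := by
    unfold successCount
    exact Measurable.tsum fun k => hk k n s
  have hkD (g : Ground) (k n s : ℕ) : Measurable fun D : Plane =>
      if (g k).1 = true ∧ ((g k).2, D) ∈ C then p.successAt g k n s D else 0 := by
    have h := Measurable.comp (hk k n s) (measurable_prodMk_left (x := g))
    exact h
  have h1 (g : Ground) : ∑' k, ∫⁻ m : Mark L M, (p.numScheduled m.Nm : ℝ≥0∞) * ∫⁻ D,
      (if (g k).1 = true ∧ ((g k).2, D) ∈ C then
        p.successAt g k (p.slots m.Nm) (slot (p.slots m.Nm)) D else 0) ∂p.unifDisc ∂p.markLaw =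
      ∫⁻ m : Mark L M, (p.numScheduled m.Nm : ℝ≥0∞) * ∫⁻ D, p.successCount (p.slots m.Nm)
        (slot (p.slots m.Nm)) D {x | (x, D) ∈ C} g ∂p.unifDisc ∂p.markLaw := by
    rw [← lintegral_tsum]
    · refine lintegral_congr fun m => ?_
      rw [ENNReal.tsum_mul_left, ← lintegral_tsum fun k => (hkD g k _ _).aemeasurable]
      rfl
    · exact fun k => (measurable_of_countable_cases Mark.measurable_Nm
        (F := fun N _ => (p.numScheduled N : ℝ≥0∞) * ∫⁻ D,
          (if (g k).1 = true ∧ ((g k).2, D) ∈ C then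
            p.successAt g k (p.slots N) (slot (p.slots N)) D else 0) ∂p.unifDisc)
        fun N => measurable_const).aemeasurable
  simp only [h1]
  rw [lintegral_lintegral_swap]
  · refine lintegral_congr fun m => ?_
    have hm := hcount (p.slots m.Nm) (slot (p.slots m.Nm))
    rw [lintegral_const_mul _ hm.lintegral_prod_right']
    congr 1
    exact lintegral_lintegral_swap hm.aemeasurable
  · refine (measurable_of_countable_cases (h := fun q : Ground × Mark L M => q.2.Nm)
      (F := fun N q => (p.numScheduled N : ℝ≥0∞) * ∫⁻ D, p.successCount (p.slots N)
        (slot (p.slots N)) D {x | (x, D) ∈ C} q.1 ∂p.unifDisc)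
      (Mark.measurable_Nm.comp measurable_snd) fun N => ?_).aemeasurable
    exact ((hcount _ _).lintegral_prod_right'.comp measurable_fst).const_mul _

open scoped Classical in
/-- The mean number of served requests in `K`. For a fixed relative position `D` of the user, the
clusters that count are those with centre in `K - D`, a set with the area of `K`, so that Campbell's
formula applies before the integration over `D`. -/
theorem lintegral_Ns (hQ : IsHardCoreProcess Q lamP δ) (hδ : 0 < δ) {slot : ℕ → ℕ}
    (hslot : ∀ n, 1 ≤ n → slot n < n) {K : Set Plane} (hK : MeasurableSet K)
    (hK' : volume K ≠ ∞) :
    ∫⁻ ω, p.Ns K ω ∂p.networkLaw Q =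
      volume K * ∫⁻ g, ∑' k, (if (g k).1 = true ∧ (g k).2 ∈ unitSquare then
        p.meanServed slot (fun _ => 1) g k else 0) ∂Q := by
  have := hQ.isProbabilityMeasure
  have hcK : MeasurableSet {q : Plane × Plane | q.1 + q.2 ∈ K} := measurable_add hK
  -- the number of served requests in `K`, given the ground process
  have hterm (k : ℕ) : Measurable fun ω : Network L M => if ω.Present k then
      ∑ i ∈ Finset.range (ω.mark k).Nr,
        if ω.center k + (ω.mark k).D i ∈ K ∧ p.Served ω k i then (1 : ℝ≥0∞) else 0
      else 0 := by
    refine Measurable.ite ((measurableSet_present k).preimage measurable_fst)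
      (measurable_sum_range_Nr k fun i => Measurable.ite (MeasurableSet.inter ?_
        (p.measurableSet_served k i)) measurable_const measurable_const) measurable_const
    have h1 : Measurable fun ω : Network L M => ω.center k := by
      unfold Network.center; fun_prop
    exact (h1.add ((Mark.measurable_D i).comp (measurable_mark k))) hK
  have hNs : Measurable fun ω : Network L M => p.Ns K ω := by
    unfold Ns
    exact Measurable.tsum hterm
  have h1 : ∫⁻ ω, p.Ns K ω ∂p.networkLaw Q =
      ∫⁻ g, ∑' k, ∫⁻ m, (p.numScheduled m.Nm : ℝ≥0∞) * ∫⁻ D,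
        (if (g k).1 = true ∧ ((g k).2, D) ∈ {q : Plane × Plane | q.1 + q.2 ∈ K} then
          p.successAt g k (p.slots m.Nm) (slot (p.slots m.Nm)) D else 0)
        ∂p.unifDisc ∂p.markLaw ∂Q := by
    change ∫⁻ ω, p.Ns K ω ∂(Q.prod p.randomnessLaw) = _
    rw [lintegral_prod _ hNs.aemeasurable]
    refine lintegral_congr fun g => ?_
    unfold Ns
    rw [lintegral_tsum fun k => by
      have h := Measurable.comp (hterm k) (measurable_prodMk_left (x := g))
      exact Measurable.aemeasurable h]
    refine tsum_congr fun k => ?_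
    by_cases hp : (g k).1 = true
    · have h := p.lintegral_sum_served g k
        (u := fun _ D => if (g k).2 + D ∈ K then 1 else 0)
        (fun N => Measurable.ite (hK.preimage (measurable_const_add _)) measurable_const
          measurable_const) hslot
      have h2 (z : Randomness L M) : (if Network.Present (g, z) k then
          ∑ i ∈ Finset.range (Network.mark (g, z) k).Nr,
            if Network.center (g, z) k + (Network.mark (g, z) k).D i ∈ K ∧
              p.Served (g, z) k i then (1 : ℝ≥0∞) else 0 else 0) =
          ∑ i ∈ Finset.range (z.1 k).Nr, if p.Served (g, z) k i then
            (if (g k).2 + (z.1 k).D i ∈ K then 1 else 0) else 0 := by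
        rw [if_pos (show Network.Present (g, z) k from hp)]
        refine Finset.sum_congr rfl fun i _ => ?_
        rw [← ite_and]
        exact if_congr and_comm rfl rfl
      simp only [h2]
      rw [h]
      simp only [hp, true_and, Set.mem_ofPred_eq, ite_mul, one_mul, zero_mul]
    · have h2 (z : Randomness L M) : ¬ Network.Present (g, z) k := hp
      simp [h2, hp]
  have h2 : ∫⁻ g, ∑' k, (if (g k).1 = true ∧ (g k).2 ∈ unitSquare then
      p.meanServed slot (fun _ => 1) g k else 0) ∂Q =
      ∫⁻ m, (p.numScheduled m.Nm : ℝ≥0∞) * ∫⁻ D, ∫⁻ g, p.successCount (p.slots m.Nm)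
        (slot (p.slots m.Nm)) D {x | (x, D) ∈ unitSquare ×ˢ (Set.univ : Set Plane)} g
          ∂Q ∂p.unifDisc ∂p.markLaw := by
    refine (lintegral_congr fun g => tsum_congr fun k => ?_).trans
      (p.lintegral_tsum_meanServed slot (measurableSet_unitSquare.prod .univ))
    by_cases h : (g k).1 = true ∧ (g k).2 ∈ unitSquare
    · simp [h.1, h.2, meanServed]
    · have h' (D : Plane) : ¬ ((g k).1 = true ∧
          ((g k).2, D) ∈ unitSquare ×ˢ (Set.univ : Set Plane)) := fun hD => h ⟨hD.1, hD.2.1⟩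
      rw [if_neg h]
      simp only [if_neg (h' _), lintegral_zero, mul_zero]
  rw [h1, h2, p.lintegral_tsum_meanServed slot hcK, ← lintegral_const_mul' _ _ hK']
  refine lintegral_congr fun m => ?_
  rw [mul_left_comm, ← lintegral_const_mul' _ _ hK']
  congr 1
  refine lintegral_congr fun D => ?_
  have hD : MeasurableSet {x | x + D ∈ K} := (measurable_add_const D) hK
  have hv : volume {x : Plane | x + D ∈ K} = volume K := measure_preimage_add_right volume D K
  have hU : {x : Plane | (x, D) ∈ unitSquare ×ˢ (Set.univ : Set Plane)} = unitSquare := by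
    ext x; simp
  rw [hU]
  exact (p.lintegral_successCount hQ hδ _ _ D hD).trans (by rw [hv])

end D2DParams

theorem theorem1 {L M : ℕ} (p : D2DParams L M) (Q : Measure Ground) (lamP δ : ℝ)
    (hlamP : 0 < lamP) (hδ : 2 * p.Rc ≤ δ) (hQ : IsHardCoreProcess Q lamP δ)
    -- `slot n` is any of the slots of a cluster with `n` slots
    (slot : ℕ → ℕ) (hslot : ∀ n, 1 ≤ n → slot n < n) :
    p.localMetric Q lamP =
      (∫⁻ z, (p.numScheduled (z.2.mark z.1).Nm : ℝ≥0∞) *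
        p.success z.2 z.1 (p.slots (z.2.mark z.1).Nm) (slot (p.slots (z.2.mark z.1).Nm))
          ∂p.palm Q lamP) /
      (∫⁻ z, ((z.2.mark z.1).Nr : ℝ≥0∞) ∂p.palm Q lamP) ∧
    (∀ K : Set Plane, IsCompact K → volume K ≠ 0 →
      p.globalMetric Q K =
        ENNReal.ofReal lamP * volume (Metric.ball (0 : Plane) p.Rc) * p.localMetric Q lamP) ∧
    p.averageRate Q lamP =
      ENNReal.ofReal p.R * ∫⁻ z, (if 1 ≤ (z.2.mark z.1).Nm then
        p.success z.2 z.1 (p.slots (z.2.mark z.1).Nm) (slot (p.slots (z.2.mark z.1).Nm))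
        else 0) ∂p.palm Q lamP := by
  classical
  have := hQ.isProbabilityMeasure
  have hδ' : 0 < δ := by linarith [p.Rc_pos]
  refine ⟨?_, fun K hK hK0 => ?_, ?_⟩
  · have h := p.lintegral_palm_served_eq_success (Q := Q) (lamP := lamP) (fun _ => 1) hslot
    simp only [one_mul] at h
    rw [← h]
    rfl
  · have h := p.lintegral_palm_served (Q := Q) (lamP := lamP) (fun _ => 1) hslot
    have hNsc : ∫⁻ z, p.Nsc z.2 z.1 ∂p.palm Q lamP = _ := h
    have hl : ENNReal.ofReal lamP ≠ 0 := by simpa using hlamP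
    have hV : volume (Metric.ball (0 : Plane) p.Rc) ≠ 0 :=
      (Metric.measure_ball_pos volume 0 p.Rc_pos).ne'
    have hV' : volume (Metric.ball (0 : Plane) p.Rc) ≠ ∞ := measure_ball_lt_top.ne
    unfold D2DParams.globalMetric D2DParams.localMetric
    rw [hNsc, p.lintegral_palm_Nr hQ hlamP, p.lintegral_Ns hQ hδ' hslot hK.measurableSet
      hK.measure_lt_top.ne]
    set X := ∫⁻ g, ∑' k, (if (g k).1 = true ∧ (g k).2 ∈ unitSquare then
      p.meanServed slot (fun _ => 1) g k else 0) ∂Q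
    set V := volume (Metric.ball (0 : Plane) p.Rc)
    rw [mul_comm (ENNReal.ofReal p.lamR) (volume K),
      ENNReal.mul_div_mul_left _ _ hK0 hK.measure_lt_top.ne, mul_comm (ENNReal.ofReal p.lamR) V,
      ← mul_div_assoc, mul_comm (ENNReal.ofReal lamP) V, mul_assoc, ← mul_assoc (ENNReal.ofReal lamP),
      ENNReal.mul_inv_cancel hl ENNReal.ofReal_ne_top, one_mul, ENNReal.mul_div_mul_left _ _ hV hV']
  -- the weight `1 / numScheduled N` turns the number of scheduled requests into `1` if `1 ≤ N`
  · have h := p.lintegral_palm_served_eq_success (Q := Q) (lamP := lamP)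
      (fun N => (p.numScheduled N : ℝ≥0∞)⁻¹) hslot
    unfold D2DParams.averageRate
    congr 1
    simp only [p.sum_scheduled, div_eq_mul_inv, ite_mul, one_mul, zero_mul]
    rw [h]
    refine lintegral_congr fun z => ?_
    by_cases hN : 1 ≤ (z.2.mark z.1).Nm
    · have h1 : (p.numScheduled (z.2.mark z.1).Nm : ℝ≥0∞) ≠ 0 := by
        exact_mod_cast (Nat.one_le_iff_ne_zero.1 (p.one_le_numScheduled hN))
      rw [if_pos hN, ENNReal.inv_mul_cancel h1 (ENNReal.natCast_ne_top _), one_mul]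
    · have h0 : (z.2.mark z.1).Nm = 0 := by omega
      rw [if_neg hN, h0, p.numScheduled_zero]
      simp
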